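/- Let $q$ be a prime power, let $F$ be the finite field with $q$ elements, and let $U_n$ be the group of upper triangular $n\times n$ matrices over $F$ with all diagonal entries equal to $1$. Let $P_{n,i}$ be the subgroup of all $A\in U_n$ whose $i$-th column is zero off the diagonal. For $1\le i<j\le n$ let $$Q_{n,i,j}=\{A\in U_n : a_{y,i}=0 \text{ for } 1\le y\le i-1,\ \text{and } a_{x,j}=0 \text{ for } 1\le x\le j-1,\ x\neq i\};$$ in particular, for $n\ge 3$, $Q_{n,1,3}$ consists of all matrices in $U_n$ whose $(2,3)$-entry is zero. For a finite group $G$ let $N_k(G)$ be the number of irreducible complex characters $\chi$ of $G$ with $\chi(1)=k$. Then: 1. For every $n\ge 6$, $N_q(P_{n-1,2})=q^{n-4}(q-1)\,[\,q^2+(n-5)q+1\,]$. 2. For every $n\ge 4$, $N_q(Q_{n,1,3})=q^2\,N_q(P_{n-1,2})$. 3. For every $n\ge 6$, $N_q(Q_{n,1,3})=q^{n-2}(q-1)\,[\,q^2+(n-5)q+1\,]$. 4. $N_q(P_{3,2})=N_q(Q_{4,1,3})=0$, $N_q(P_{4,2})=q(q^2-1)$ and $N_q(Q_{5,1,3})=q^3(q^2-1)$.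 -/

import Mathlib

open scoped MatrixGroups

/-- The group `U_n` of upper triangular `n × n` matrices over `F` all of whose diagonal entries
are equal to `1`. -/
def unitriangularGroup (F : Type*) [Field F] (n : ℕ) : Subgroup (GL (Fin n) F) where
  carrier := {A | (∀ k l : Fin n, l < k → A k l = 0) ∧ ∀ k : Fin n, A k k = 1}
  one_mem' := ⟨fun k l h => by simp [h.ne'], fun k => by simp⟩
  mul_mem' := by
    rintro A B ⟨hA, hA'⟩ ⟨hB, hB'⟩
    refine ⟨fun k l h => ?_, fun k => ?_⟩
    · rw [Matrix.GeneralLinearGroup.coe_mul, Matrix.mul_apply]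
      refine Finset.sum_eq_zero fun m _ => ?_
      rcases lt_or_ge m k with hm | hm
      · rw [hA k m hm, zero_mul]
      · rw [hB m l (h.trans_le hm), mul_zero]
    · rw [Matrix.GeneralLinearGroup.coe_mul, Matrix.mul_apply, Finset.sum_eq_single k]
      · rw [hA', hB', mul_one]
      · intro m _ hmk
        rcases lt_or_gt_of_ne hmk with hm | hm
        · rw [hA k m hm, zero_mul]
        · rw [hB m k hm, mul_zero]
      · simp
  inv_mem' := by
    rintro A ⟨hA, hA'⟩
    have hT : ∀ k l : Fin n, l < k → (A⁻¹ : GL (Fin n) F) k l = 0 := by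
      intro k l h
      have : Matrix.BlockTriangular (A : Matrix (Fin n) (Fin n) F) id := fun k l h => hA k l h
      have h2 := Matrix.blockTriangular_inv_of_blockTriangular this
      rw [Matrix.coe_units_inv]
      exact h2 h
    refine ⟨hT, fun k => ?_⟩
    have h1 : ((A⁻¹ * A : GL (Fin n) F) : Matrix (Fin n) (Fin n) F) k k = 1 := by simp
    rw [Matrix.GeneralLinearGroup.coe_mul, Matrix.mul_apply, Finset.sum_eq_single k] at h1
    · rwa [hA', mul_one] at h1
    · intro m _ hmk
      rcases lt_or_gt_of_ne hmk with hm | hm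
      · rw [hT k m hm, zero_mul]
      · rw [hA m k hm, mul_zero]
    · simp

/-- The group `P_{n,i}` of all `A ∈ U_n` whose `i`-th column is trivial, that is, whose only nonzero
entry in that column is the diagonal one. Here `i` is counted from `1`, so that the `i`-th column
is the one whose index `l : Fin n` has `l + 1 = i`. -/
def pGroup (F : Type*) [Field F] (n i : ℕ) : Subgroup (GL (Fin n) F) where
  carrier := {A | A ∈ unitriangularGroup F n ∧
    ∀ k l : Fin n, (l : ℕ) + 1 = i → k ≠ l → A k l = 0}
  one_mem' := ⟨one_mem _, fun k l _ h => by simp [h]⟩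
  mul_mem' := by
    rintro A B ⟨hA, hA'⟩ ⟨hB, hB'⟩
    refine ⟨mul_mem hA hB, fun k l hl hkl => ?_⟩
    rw [Matrix.GeneralLinearGroup.coe_mul, Matrix.mul_apply]
    refine Finset.sum_eq_zero fun m _ => ?_
    by_cases hm : m = l
    · rw [hm, hA' k l hl hkl, zero_mul]
    · rw [hB' m l hl hm, mul_zero]
  inv_mem' := by
    rintro A ⟨hA, hA'⟩
    refine ⟨inv_mem hA, fun k l hl hkl => ?_⟩
    have h1 : ((A⁻¹ * A : GL (Fin n) F) : Matrix (Fin n) (Fin n) F) k l = 0 := by simp [hkl]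
    rw [Matrix.GeneralLinearGroup.coe_mul, Matrix.mul_apply, Finset.sum_eq_single l] at h1
    · rwa [hA.2 l, mul_one] at h1
    · intro m _ hm
      rw [hA' m l hl hm, mul_zero]
    · simp

/-- The group `Q_{n,i,j}` (used for `i < j`) of all `A ∈ U_n` with `a_{y,i} = 0` for `1 ≤ y ≤ i - 1` and
`a_{x,j} = 0` for all `x ≠ i` with `1 ≤ x ≤ j - 1`. Here `i` and `j` are counted from `1`, so that an
index `l : Fin n` stands for the row or column number `l + 1`. -/
def qGroup (F : Type*) [Field F] (n i j : ℕ) : Subgroup (GL (Fin n) F) where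
  carrier := {A | A ∈ unitriangularGroup F n ∧
    (∀ y l : Fin n, (l : ℕ) + 1 = i → y < l → A y l = 0) ∧
    ∀ x l : Fin n, (l : ℕ) + 1 = j → x < l → (x : ℕ) + 1 ≠ i → A x l = 0}
  one_mem' := ⟨one_mem _, fun k l _ h => by simp [h.ne], fun k l _ h _ => by simp [h.ne]⟩
  mul_mem' := by
    rintro A B ⟨hA, hA', hA''⟩ ⟨hB, hB', hB''⟩
    refine ⟨mul_mem hA hB, fun k l hl hkl => ?_, fun k l hl hkl hki => ?_⟩
    · rw [Matrix.GeneralLinearGroup.coe_mul, Matrix.mul_apply]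
      refine Finset.sum_eq_zero fun m _ => ?_
      rcases lt_trichotomy m l with hm | hm | hm
      · rw [hB' m l hl hm, mul_zero]
      · rw [hm, hA' k l hl hkl, zero_mul]
      · rw [hB.1 m l hm, mul_zero]
    · rw [Matrix.GeneralLinearGroup.coe_mul, Matrix.mul_apply]
      refine Finset.sum_eq_zero fun m _ => ?_
      rcases lt_trichotomy m l with hm | hm | hm
      · by_cases hmi : (m : ℕ) + 1 = i
        · rcases lt_trichotomy k m with hk | hk | hk
          · rw [hA' k m hmi hk, zero_mul]
          · exact absurd (hk ▸ hmi) hki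
          · rw [hA.1 k m hk, zero_mul]
        · rw [hB'' m l hl hm hmi, mul_zero]
      · rw [hm, hA'' k l hl hkl hki, zero_mul]
      · rw [hB.1 m l hm, mul_zero]
  inv_mem' := by
    rintro A ⟨hA, hA', hA''⟩
    have hI := inv_mem hA
    have h0 : ∀ y l : Fin n, (l : ℕ) + 1 = i → y < l → (A⁻¹ : GL (Fin n) F) y l = 0 := by
      intro k l hl hkl
      have h1 : ((A⁻¹ * A : GL (Fin n) F) : Matrix (Fin n) (Fin n) F) k l = 0 := by simp [hkl.ne]
      rw [Matrix.GeneralLinearGroup.coe_mul, Matrix.mul_apply, Finset.sum_eq_single l] at h1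
      · rwa [hA.2 l, mul_one] at h1
      · intro m _ hml
        rcases lt_or_gt_of_ne hml with hm | hm
        · rw [hA' m l hl hm, mul_zero]
        · rw [hA.1 m l hm, mul_zero]
      · simp
    refine ⟨hI, h0, fun k l hl hkl hki => ?_⟩
    have h1 : ((A⁻¹ * A : GL (Fin n) F) : Matrix (Fin n) (Fin n) F) k l = 0 := by simp [hkl.ne]
    rw [Matrix.GeneralLinearGroup.coe_mul, Matrix.mul_apply, Finset.sum_eq_single l] at h1
    · rwa [hA.2 l, mul_one] at h1
    · intro m _ hml
      rcases lt_or_gt_of_ne hml with hm | hm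
      · by_cases hmi : (m : ℕ) + 1 = i
        · rcases lt_trichotomy k m with hk | hk | hk
          · rw [h0 k m hmi hk, zero_mul]
          · exact absurd (hk ▸ hmi) hki
          · rw [hI.1 k m hk, zero_mul]
        · rw [hA'' m l hl hm hmi, mul_zero]
      · rw [hA.1 m l hm, mul_zero]
    · simp

/-- The set `Irr(G)` of irreducible complex characters of `G`: the characters of the irreducible
representations of `G` on some `ℂ^d`. -/
def irrCharacters (G : Type*) [Group G] : Set (G → ℂ) :=
  {χ | ∃ (d : ℕ) (ρ : Representation ℂ G (Fin d → ℂ)), ρ.IsIrreducible ∧ ρ.character = χ}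

/-- `N_k(G)`, the number of irreducible complex characters of `G` of degree `χ(1) = k`. -/
noncomputable def numIrrCharacters (k : ℕ) (G : Type*) [Group G] : ℕ :=
  Set.ncard {χ : G → ℂ | χ ∈ irrCharacters G ∧ χ 1 = (k : ℂ)}

/-!
Splitting off the last column of a unitriangular matrix exhibits `P_{n+1,2}` and `Q_{n+1,1,3}` as
semidirect products `F ^ n ⋊ H`, where `H` is `P_{n,2}`, respectively `Q_{n,1,3}`, acting on column
vectors. More abstractly, if `H` acts linearly on `M`, then `M ⋊ H` acts linearly on `M × F`,
extending its affine action on `M`, and both families arise by iterating this construction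
(`FiniteLinearGroup.tower`, `numIrrCharacters_eq_numIrr_tower`). They start with the trivial group
acting on `F ^ 2` and with an abelian group of order `q ^ 2` acting on `F ^ 3`; for the purpose of
counting these two differ only in the number `a` of linear characters of the initial group, which is
`1` or `q ^ 2`. This is the source of the factor `q ^ 2` between the two families.

The characters of degree `q` of `M ⋊ H` are found by Clifford theory for the abelian normal subgroup
`M`. After the choice of a nontrivial additive character `ψ` of `F`, the characters of `M` are the
`ψ ∘ w` for linear forms `w` on `M`. The weights of an irreducible representation contain a full
`H`-orbit of linear forms, and so the orbit has at most `q` elements. If the weight is fixed by `H`,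
the representation is a twist of an irreducible representation of `H` (`exists_eq_twistRep`). If its
orbit has exactly `q` elements, the weight spaces are lines, and the representation is induced from
a linear character of the stabilizer (`exists_character_eq_monomialRep`). Together these give
`numIrrCharacters_affine`.

For `M × F` in place of `M` and `M ⋊ H` in place of `H`, a linear form `(x, t) ↦ u x + t d` is fixed
if and only if `u = 0`. If `u ≠ 0` its orbit has at least `q` elements, with equality if and only if
`u` is fixed by `H`, and then the stabilizer is `ker u ⋊ H`. This turns the count into the recursion
`numIrrCharacters_affine_affineRep`, whose inhomogeneous term only involves numbers of linear
characters; these are products of numbers of fixed linear forms (`card_affine_monoidHom_units`).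
Solving the recursion gives `FiniteLinearGroup.IsBase.numIrr_tower`.
-/

universe u

/-! ### Irreducible representations and their characters -/

namespace Representation

section Irreducible

variable {k G V W : Type*} [Field k] [Group G] [AddCommGroup V] [Module k V]
  [AddCommGroup W] [Module k W]

/-- A form of irreducibility phrased with stable submodules instead of the lattice of
subrepresentations. -/
theorem isIrreducible_iff_forall_submodule {ρ : Representation k G V} :
    ρ.IsIrreducible ↔
      Nontrivial V ∧ ∀ U : Submodule k V, (∀ g, ∀ v ∈ U, ρ g v ∈ U) → U = ⊥ ∨ U = ⊤ := by
  constructor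
  · intro h
    refine ⟨?_, fun U hU => ?_⟩
    · by_contra hV
      rw [not_nontrivial_iff_subsingleton] at hV
      refine bot_ne_top (α := Subrepresentation ρ) ?_
      exact Subrepresentation.toSubmodule_injective (Subsingleton.elim _ _)
    · rcases h.eq_bot_or_eq_top (⟨U, fun g v hv => hU g v hv⟩ : Subrepresentation ρ) with h1 | h1
      · exact Or.inl (congrArg Subrepresentation.toSubmodule h1)
      · exact Or.inr (congrArg Subrepresentation.toSubmodule h1)
  · rintro ⟨hV, h⟩
    refine { exists_pair_ne := ⟨⊥, ⊤, fun h1 => ?_⟩, eq_bot_or_eq_top := fun U => ?_ }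
    · exact bot_ne_top (α := Submodule k V) (congrArg Subrepresentation.toSubmodule h1)
    · rcases h U.toSubmodule (fun g v hv => U.apply_mem_toSubmodule g hv) with h1 | h1
      · exact Or.inl (Subrepresentation.toSubmodule_injective h1)
      · exact Or.inr (Subrepresentation.toSubmodule_injective h1)

theorem IsIrreducible.nontrivial {ρ : Representation k G V} (h : ρ.IsIrreducible) :
    Nontrivial V :=
  (isIrreducible_iff_forall_submodule.1 h).1

theorem IsIrreducible.eq_top {ρ : Representation k G V} (h : ρ.IsIrreducible)
    {U : Submodule k V} (hU : ∀ g, ∀ v ∈ U, ρ g v ∈ U) (h0 : U ≠ ⊥) : U = ⊤ :=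
  ((isIrreducible_iff_forall_submodule.1 h).2 U hU).resolve_left h0

theorem IsIrreducible.of_equiv {ρ : Representation k G V} {σ : Representation k G W}
    (e : Equiv ρ σ) (h : ρ.IsIrreducible) : σ.IsIrreducible := by
  have hc : ∀ g w, e.symm (σ g w) = ρ g (e.symm w) := fun g w =>
    IntertwiningMap.isIntertwining _ _ e.symm.toIntertwiningMap g w
  rw [isIrreducible_iff_forall_submodule] at h ⊢
  obtain ⟨hV, h⟩ := h
  refine ⟨e.symm.toLinearEquiv.toEquiv.nontrivial, fun U hU => ?_⟩
  have hU' : ∀ g, ∀ v ∈ U.map (e.symm.toLinearEquiv : W →ₗ[k] V),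
      ρ g v ∈ U.map (e.symm.toLinearEquiv : W →ₗ[k] V) := by
    rintro g _ ⟨w, hw, rfl⟩
    exact ⟨σ g w, hU g w hw, hc g w⟩
  rcases h _ hU' with h1 | h1
  · exact Or.inl (Submodule.map_eq_bot_iff.1 h1)
  · exact Or.inr (Submodule.map_eq_top_iff.1 h1)

theorem IsIrreducible.comp_of_surjective {H : Type*} [Group H] {ρ : Representation k G V}
    (h : ρ.IsIrreducible) {f : H →* G} (hf : Function.Surjective f) :
    IsIrreducible (MonoidHom.comp ρ f : Representation k H V) := by
  rw [isIrreducible_iff_forall_submodule] at h ⊢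
  refine ⟨h.1, fun U hU => h.2 U fun g v hv => ?_⟩
  obtain ⟨x, rfl⟩ := hf g
  exact hU x v hv

end Irreducible

section Character

variable {G : Type*} [Group G] {V W : Type*} [AddCommGroup V] [Module ℂ V]
  [FiniteDimensional ℂ V] [AddCommGroup W] [Module ℂ W] [FiniteDimensional ℂ W]

theorem IsIrreducible.character_mem_irrCharacters {σ : Representation ℂ G V}
    (h : σ.IsIrreducible) : σ.character ∈ irrCharacters G := by
  let e : V ≃ₗ[ℂ] (Fin (Module.finrank ℂ V) → ℂ) := (Module.finBasis ℂ V).equivFun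
  let τ : Representation ℂ G (Fin (Module.finrank ℂ V) → ℂ) :=
    MonoidHom.comp (e.conjAlgEquiv ℂ : (V →ₗ[ℂ] V) →* _) σ
  let φ : Equiv σ τ := Equiv.mk e fun g => by
    ext v : 1
    simp [τ, LinearEquiv.conjAlgEquiv]
  exact ⟨_, τ, h.of_equiv φ, (char_iso φ).symm⟩

theorem exists_of_mem_irrCharacters {k : ℕ} {χ : G → ℂ} (h : χ ∈ irrCharacters G)
    (hk : χ 1 = k) :
    ∃ σ : Representation ℂ G (Fin k → ℂ), σ.IsIrreducible ∧ σ.character = χ := by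
  obtain ⟨d, σ, hσ, rfl⟩ := h
  rw [char_one, Module.finrank_fin_fun, Nat.cast_inj] at hk
  subst hk
  exact ⟨σ, hσ, rfl⟩

/-- Over `ℂ` an irreducible representation of a finite group is determined by its character. -/
theorem nonempty_equiv_of_character_eq [Finite G] {σ : Representation ℂ G V}
    {τ : Representation ℂ G W} (hσ : σ.IsIrreducible) (hτ : τ.IsIrreducible)
    (h : σ.character = τ.character) : Nonempty (Equiv σ τ) := by
  classical
  have := Fintype.ofFinite G
  have hG : (Nat.card G : ℂ) ≠ 0 := by exact_mod_cast Nat.card_pos.ne'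
  let _ := invertibleOfNonzero hG
  have h1 := char_orthonormal τ σ
  have h2 := char_orthonormal τ τ
  rw [if_pos ⟨Equiv.refl τ⟩] at h2
  rw [h, h2] at h1
  by_contra hne
  rw [if_neg hne] at h1
  exact one_ne_zero h1

end Character

end Representation

section Finiteness

open Representation

/-- The irreducible characters of a finite group are linearly independent, hence finite in
number. -/
theorem finite_irrCharacters (G : Type*) [Group G] [Finite G] : (irrCharacters G).Finite := by
  classical
  have := Fintype.ofFinite G
  have hG : (Nat.card G : ℂ) ≠ 0 := by exact_mod_cast Nat.card_pos.ne'
  let _ := invertibleOfNonzero hG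
  have hli : LinearIndependent ℂ (fun χ : irrCharacters G => (χ : G → ℂ)) := by
    rw [linearIndependent_iff']
    intro s c hc χ hχ
    have key : ∀ θ ∈ s, (Nat.card G : ℂ)⁻¹ * ∑ g : G, (θ : G → ℂ) g * (χ : G → ℂ) g⁻¹ =
        if θ = χ then 1 else 0 := by
      intro θ _
      obtain ⟨d, ρ, hρ, h1⟩ := θ.2
      obtain ⟨d', σ, hσ, h2⟩ := χ.2
      have h3 : Nonempty (Equiv σ ρ) ↔ θ = χ := by
        rw [Subtype.ext_iff, ← h1, ← h2]
        exact ⟨fun ⟨e⟩ => (char_iso e).symm,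
          fun h => nonempty_equiv_of_character_eq hσ hρ h.symm⟩
      rw [← h1, ← h2, char_orthonormal ρ σ]
      simp only [h3]
    have h0 : (Nat.card G : ℂ)⁻¹ *
        ∑ g : G, (∑ θ ∈ s, c θ • (θ : G → ℂ)) g * (χ : G → ℂ) g⁻¹ = 0 := by
      rw [hc]; simp
    have h1 : (Nat.card G : ℂ)⁻¹ *
        ∑ g : G, (∑ θ ∈ s, c θ • (θ : G → ℂ)) g * (χ : G → ℂ) g⁻¹ =
        ∑ θ ∈ s, c θ * ((Nat.card G : ℂ)⁻¹ *
          ∑ g : G, (θ : G → ℂ) g * (χ : G → ℂ) g⁻¹) := by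
      simp only [Finset.sum_apply, Pi.smul_apply, smul_eq_mul, Finset.sum_mul, Finset.mul_sum]
      rw [Finset.sum_comm]
      refine Finset.sum_congr rfl fun θ _ => Finset.sum_congr rfl fun g _ => ?_
      ring
    rw [h1, Finset.sum_congr rfl fun θ hθ => by rw [key θ hθ]] at h0
    simpa [hχ] using h0
  exact hli.setFinite

theorem comp_mem_irrCharacters {G G' : Type*} [Group G] [Group G'] (e : G ≃* G') {χ : G' → ℂ}
    (h : χ ∈ irrCharacters G') : χ ∘ e ∈ irrCharacters G := by
  obtain ⟨d, ρ, hρ, rfl⟩ := h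
  exact ⟨d, _, hρ.comp_of_surjective (f := (e : G →* G')) e.surjective, rfl⟩

theorem numIrrCharacters_congr {G G' : Type*} [Group G] [Group G'] (e : G ≃* G') (k : ℕ) :
    numIrrCharacters k G = numIrrCharacters k G' := by
  refine Set.ncard_congr (fun χ _ => χ ∘ e.symm) ?_ ?_ ?_
  · rintro χ ⟨h, h1⟩
    exact ⟨comp_mem_irrCharacters e.symm h, by simpa using h1⟩
  · intro χ θ _ _ h
    exact e.symm.surjective.injective_comp_right h
  · rintro χ ⟨h, h1⟩
    refine ⟨χ ∘ e, ⟨comp_mem_irrCharacters e h, by simpa using h1⟩, ?_⟩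
    ext x
    simp

/-- Irreducible representations of a finite commutative group have degree `1`. -/
theorem numIrrCharacters_eq_zero_of_commute {G : Type*} [Group G] [Finite G]
    (hG : ∀ a b : G, a * b = b * a) {k : ℕ} (hk : 2 ≤ k) : numIrrCharacters k G = 0 := by
  have : IsMulCommutative G := ⟨⟨hG⟩⟩
  rw [numIrrCharacters, Set.ncard_eq_zero ((finite_irrCharacters G).subset fun _ h => h.1),
    Set.eq_empty_iff_forall_notMem]
  rintro χ ⟨h, h1⟩
  obtain ⟨σ, hσ, rfl⟩ := exists_of_mem_irrCharacters h h1
  have h2 := IsIrreducible.finrank_eq_one_of_isMulCommutative σ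
  rw [Module.finrank_fin_fun] at h2
  omega

end Finiteness

/-! ### Affine groups -/

namespace Representation

section Affine

variable {F H M : Type*} [Field F] [Group H] [AddCommGroup M] [Module F M]

/-- The semidirect product `M ⋊ H` attached to a linear action `ρ` of `H` on `M`; the element with
components `m` and `h` stands for the affine transformation `x ↦ ρ h x + m` of `M`. -/
@[ext]
structure Affine (ρ : Representation F H M) where
  /-- The translation part. -/
  vec : M
  /-- The linear part. -/
  lin : H

namespace Affine

variable {ρ : Representation F H M}

instance : Mul (Affine ρ) := ⟨fun x y => ⟨x.vec + ρ x.lin y.vec, x.lin * y.lin⟩⟩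

instance : One (Affine ρ) := ⟨⟨0, 1⟩⟩

instance : Inv (Affine ρ) := ⟨fun x => ⟨-ρ x.lin⁻¹ x.vec, x.lin⁻¹⟩⟩

@[simp] theorem vec_mul (x y : Affine ρ) : (x * y).vec = x.vec + ρ x.lin y.vec := rfl

@[simp] theorem lin_mul (x y : Affine ρ) : (x * y).lin = x.lin * y.lin := rfl

@[simp] theorem vec_one : (1 : Affine ρ).vec = 0 := rfl

@[simp] theorem lin_one : (1 : Affine ρ).lin = 1 := rfl

@[simp] theorem vec_inv (x : Affine ρ) : x⁻¹.vec = -ρ x.lin⁻¹ x.vec := rfl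

@[simp] theorem lin_inv (x : Affine ρ) : x⁻¹.lin = x.lin⁻¹ := rfl

instance : Group (Affine ρ) :=
  Group.ofLeftAxioms
    (fun x y z => by ext <;> simp [add_assoc, mul_assoc])
    (fun x => by ext <;> simp)
    (fun x => by ext <;> simp)

instance [Finite H] [Finite M] : Finite (Affine ρ) :=
  Finite.of_injective (fun x : Affine ρ => (x.vec, x.lin)) fun x y h => by
    rw [Prod.mk.injEq] at h
    exact Affine.ext h.1 h.2

/-- The projection of `M ⋊ H` onto `H`. -/
def linHom (ρ : Representation F H M) : Affine ρ →* H where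
  toFun := lin
  map_one' := rfl
  map_mul' _ _ := rfl

@[simp] theorem linHom_apply (x : Affine ρ) : linHom ρ x = x.lin := rfl

/-- The complement `H` of the translations in `M ⋊ H`. -/
def ofLin (ρ : Representation F H M) : H →* Affine ρ where
  toFun h := ⟨0, h⟩
  map_one' := rfl
  map_mul' _ _ := by ext <;> simp

@[simp] theorem vec_ofLin (h : H) : (ofLin ρ h).vec = 0 := rfl

@[simp] theorem lin_ofLin (h : H) : (ofLin ρ h).lin = h := rfl

/-- The translation by a vector. -/
def ofVec (ρ : Representation F H M) (m : M) : Affine ρ := ⟨m, 1⟩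

@[simp] theorem vec_ofVec (m : M) : (ofVec ρ m).vec = m := rfl

@[simp] theorem lin_ofVec (m : M) : (ofVec ρ m).lin = 1 := rfl

theorem ofVec_zero : ofVec ρ 0 = 1 := rfl

theorem ofVec_mul_ofVec (m m' : M) : ofVec ρ m * ofVec ρ m' = ofVec ρ (m + m') := by
  ext <;> simp

theorem ofVec_mul_ofLin (m : M) (h : H) : ofVec ρ m * ofLin ρ h = ⟨m, h⟩ := by
  ext <;> simp

theorem ofVec_vec_mul_ofLin_lin (x : Affine ρ) : ofVec ρ x.vec * ofLin ρ x.lin = x :=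
  ofVec_mul_ofLin _ _

theorem ofLin_mul_ofVec (m : M) (h : H) :
    ofLin ρ h * ofVec ρ m = ofVec ρ (ρ h m) * ofLin ρ h := by
  ext <;> simp

/-- Affine groups of isomorphic representations (of isomorphic groups) are isomorphic. -/
def congr {H' M' : Type*} [Group H'] [AddCommGroup M'] [Module F M']
    {ρ' : Representation F H' M'} (e : H ≃* H') (l : M ≃ₗ[F] M')
    (hl : ∀ h m, l (ρ h m) = ρ' (e h) (l m)) : Affine ρ ≃* Affine ρ' where
  toFun x := ⟨l x.vec, e x.lin⟩
  invFun x := ⟨l.symm x.vec, e.symm x.lin⟩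
  left_inv x := by ext <;> simp
  right_inv x := by ext <;> simp
  map_mul' x y := by ext <;> simp [hl]

end Affine

end Affine

/-! ### Weights of the translation subgroup -/

section Weight

variable {F H M : Type*} [Field F] [Group H] [AddCommGroup M] [Module F M]

theorem dual_apply_apply (ρ : Representation F H M) (h : H) (w : Module.Dual F M) (m : M) :
    ρ.dual h w m = w (ρ h⁻¹ m) := rfl

theorem mem_invariants_dual {ρ : Representation F H M} {w : Module.Dual F M} :
    w ∈ ρ.dual.invariants ↔ ∀ h m, w (ρ h m) = w m := by
  rw [mem_invariants]
  refine ⟨fun h x m => ?_, fun h x => LinearMap.ext fun m => ?_⟩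
  · rw [← inv_inv x]
    exact LinearMap.congr_fun (h x⁻¹) m
  · exact h x⁻¹ m

/-- The stabilizer in `H` of a linear form on `M`. -/
def dualStabilizer (ρ : Representation F H M) (w : Module.Dual F M) : Subgroup H where
  carrier := {h | ρ.dual h w = w}
  one_mem' := by rw [Set.mem_ofPred_eq, map_one, Module.End.one_apply]
  mul_mem' {a b} ha hb := by
    simp only [Set.mem_ofPred_eq] at ha hb ⊢
    rw [map_mul, Module.End.mul_apply, hb, ha]
  inv_mem' {a} ha := by
    simp only [Set.mem_ofPred_eq] at ha ⊢
    nth_rw 1 [← ha]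
    rw [← Module.End.mul_apply, ← map_mul, inv_mul_cancel, map_one, Module.End.one_apply]

theorem mem_dualStabilizer {ρ : Representation F H M} {w : Module.Dual F M} {h : H} :
    h ∈ dualStabilizer ρ w ↔ ρ.dual h w = w := Iff.rfl

theorem apply_of_mem_dualStabilizer {ρ : Representation F H M} {w : Module.Dual F M} {h : H}
    (hh : h ∈ dualStabilizer ρ w) (m : M) : w (ρ h m) = w m := by
  rw [← inv_inv h]
  exact LinearMap.congr_fun (mem_dualStabilizer.1 (inv_mem hh)) m

/-- The orbit under `H` of a linear form on `M`. -/
def dualOrbit (ρ : Representation F H M) (w : Module.Dual F M) : Set (Module.Dual F M) :=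
  Set.range fun h => ρ.dual h w

theorem index_dualStabilizer (ρ : Representation F H M) (w : Module.Dual F M) :
    (dualStabilizer ρ w).index = (dualOrbit ρ w).ncard := by
  let f : H ⧸ dualStabilizer ρ w → Module.Dual F M :=
    fun x => Quotient.liftOn' x (fun h => ρ.dual h w) fun a b hab => by
      rw [QuotientGroup.leftRel_apply, mem_dualStabilizer, map_mul, Module.End.mul_apply] at hab
      have h1 := congrArg (ρ.dual a) hab
      rwa [← Module.End.mul_apply, ← map_mul, mul_inv_cancel, map_one, Module.End.one_apply,
        eq_comm] at h1
  have hf : Function.Injective f := by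
    intro x y
    induction x using Quotient.inductionOn'
    induction y using Quotient.inductionOn'
    rename_i a b
    intro hab
    change ρ.dual a w = ρ.dual b w at hab
    refine Quotient.sound' ?_
    rw [QuotientGroup.leftRel_apply, mem_dualStabilizer, map_mul, Module.End.mul_apply, ← hab,
      ← Module.End.mul_apply, ← map_mul, inv_mul_cancel, map_one, Module.End.one_apply]
  have hr : Set.range f = dualOrbit ρ w := by
    ext v
    constructor
    · rintro ⟨x, rfl⟩
      induction x using Quotient.inductionOn'
      exact ⟨_, rfl⟩
    · rintro ⟨h, rfl⟩
      exact ⟨(h : H ⧸ dualStabilizer ρ w), rfl⟩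
  rw [Subgroup.index, ← hr, ← Nat.card_coe_set_eq, Nat.card_congr (Equiv.ofInjective f hf)]

instance [Finite F] [Finite M] : Finite (Module.Dual F M) :=
  DFunLike.finite _

theorem card_dual [Finite F] [Finite M] : Nat.card (Module.Dual F M) = Nat.card M := by
  rw [Module.natCard_eq_pow_finrank (K := F), Subspace.dual_finrank_eq,
    ← Module.natCard_eq_pow_finrank (K := F)]

theorem sum_addChar_dual_apply [Finite F] [Finite M] [Fintype (Module.Dual F M)]
    {ψ : AddChar F ℂ} (hψ : ψ ≠ 1) {m : M} (hm : m ≠ 0) :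
    ∑ w : Module.Dual F M, ψ (w m) = 0 := by
  let θ : AddChar (Module.Dual F M) ℂ :=
    ψ.compAddMonoidHom (Module.Dual.eval F M m).toAddMonoidHom
  refine (AddChar.sum_eq_zero_iff_ne_zero (ψ := θ)).2 (AddChar.ne_zero_iff.2 ?_)
  obtain ⟨a, ha⟩ := AddChar.ne_one_iff.1 hψ
  obtain ⟨w, hw⟩ := Module.Projective.exists_dual_eq_one F hm
  refine ⟨a • w, ?_⟩
  change ψ (a • w m) ≠ 1
  rwa [hw, smul_eq_mul, mul_one]

theorem sum_addChar_apply [Finite F] [Fintype M]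
    {ψ : AddChar F ℂ} (hψ : ψ ≠ 1) {w : Module.Dual F M} (hw : w ≠ 0) :
    ∑ m : M, ψ (w m) = 0 := by
  let θ : AddChar M ℂ := ψ.compAddMonoidHom w.toAddMonoidHom
  refine (AddChar.sum_eq_zero_iff_ne_zero (ψ := θ)).2 (AddChar.ne_zero_iff.2 ?_)
  obtain ⟨a, ha⟩ := AddChar.ne_one_iff.1 hψ
  obtain ⟨m, hm⟩ := DFunLike.ne_iff.1 hw
  refine ⟨(a / w m) • m, ?_⟩
  have hm' : w m ≠ 0 := hm
  change ψ (w ((a / w m) • m)) ≠ 1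
  rwa [map_smul, smul_eq_mul, div_mul_cancel₀ _ hm']

theorem eq_of_addChar_apply_eq [Finite F] [Finite M] {ψ : AddChar F ℂ} (hψ : ψ ≠ 1)
    {w w' : Module.Dual F M} (h : ∀ m, ψ (w m) = ψ (w' m)) : w = w' := by
  have := Fintype.ofFinite M
  by_contra hne
  -- Otherwise `ψ ∘ (w - w')` is both trivial and of vanishing sum.
  have h3 := sum_addChar_apply hψ (sub_ne_zero.2 hne)
  have h4 : ∀ m, ψ ((w - w') m) = 1 := by
    intro m
    rw [LinearMap.sub_apply, AddChar.map_sub_eq_div, h, div_self]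
    exact (AddChar.val_isUnit ψ _).ne_zero
  rw [Finset.sum_congr rfl fun m _ => h4 m] at h3
  simp at h3

variable {V W : Type*} [AddCommGroup V] [Module ℂ V] [AddCommGroup W] [Module ℂ W]

/-- The weight space of the linear form `w` in a representation of `M ⋊ H`: the translation by `m`
acts on it as the scalar `ψ (w m)`. Here `ψ` is an additive character of the base field; once a
nontrivial one is fixed, all characters of the group of translations have the form `ψ ∘ w`. -/
def weightSpace (ψ : AddChar F ℂ) {ρ : Representation F H M} (σ : Representation ℂ (Affine ρ) V)
    (w : Module.Dual F M) : Submodule ℂ V where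
  carrier := {v | ∀ m, σ (Affine.ofVec ρ m) v = ψ (w m) • v}
  zero_mem' m := by simp
  add_mem' {a b} ha hb m := by rw [map_add, ha m, hb m, smul_add]
  smul_mem' c v hv m := by rw [map_smul, hv m, smul_comm]

theorem mem_weightSpace {ψ : AddChar F ℂ} {ρ : Representation F H M}
    {σ : Representation ℂ (Affine ρ) V} {w : Module.Dual F M} {v : V} :
    v ∈ weightSpace ψ σ w ↔ ∀ m, σ (Affine.ofVec ρ m) v = ψ (w m) • v := Iff.rfl

/-- The operator `∑ m, ψ (-w m) σ(m)`, which is `|M|` times the projection onto the weight space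
of `w` along the other weight spaces. -/
noncomputable def weightProj [Fintype M] (ψ : AddChar F ℂ) {ρ : Representation F H M}
    (σ : Representation ℂ (Affine ρ) V) (w : Module.Dual F M) : V →ₗ[ℂ] V :=
  ∑ m : M, ψ (-w m) • σ (Affine.ofVec ρ m)

variable {ψ : AddChar F ℂ} {ρ : Representation F H M} {σ : Representation ℂ (Affine ρ) V}

theorem weightProj_apply [Fintype M] (w : Module.Dual F M) (v : V) :
    weightProj ψ σ w v = ∑ m : M, ψ (-w m) • σ (Affine.ofVec ρ m) v := by
  simp [weightProj]

theorem weightProj_mem [Fintype M] (w : Module.Dual F M) (v : V) :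
    weightProj ψ σ w v ∈ weightSpace ψ σ w := by
  intro m'
  rw [weightProj_apply, map_sum, Finset.smul_sum]
  refine Fintype.sum_equiv (Equiv.addLeft m') _ _ fun m => ?_
  rw [map_smul, ← Module.End.mul_apply, ← map_mul, Affine.ofVec_mul_ofVec, smul_smul,
    Equiv.coe_addLeft, ← AddChar.map_add_eq_mul]
  congr 2
  rw [map_add]
  abel

theorem sum_weightProj [Finite F] [Fintype M] [Fintype (Module.Dual F M)] (hψ : ψ ≠ 1) (v : V) :
    ∑ w : Module.Dual F M, weightProj ψ σ w v = (Fintype.card (Module.Dual F M) : ℂ) • v := by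
  simp_rw [weightProj_apply]
  rw [Finset.sum_comm, Finset.sum_eq_single 0]
  · rw [Affine.ofVec_zero]
    simp [← Nat.cast_smul_eq_nsmul ℂ]
  · intro m _ hm
    rw [← Finset.sum_smul]
    have h := sum_addChar_dual_apply (F := F) hψ (neg_ne_zero.2 hm)
    simp only [map_neg] at h
    rw [h, zero_smul]
  · simp

theorem weightProj_of_mem [Fintype M] {w : Module.Dual F M} {v : V}
    (hv : v ∈ weightSpace ψ σ w) : weightProj ψ σ w v = (Fintype.card M : ℂ) • v := by
  rw [weightProj_apply]
  have h : ∀ m : M, ψ (-w m) • σ (Affine.ofVec ρ m) v = v := fun m => by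
    rw [mem_weightSpace.1 hv m, smul_smul, ← AddChar.map_add_eq_mul, neg_add_cancel,
      AddChar.map_zero_eq_one, one_smul]
  simp [h, ← Nat.cast_smul_eq_nsmul ℂ]

theorem weightProj_of_mem_of_ne [Finite F] [Fintype M] (hψ : ψ ≠ 1) {w w' : Module.Dual F M}
    (hw : w' ≠ w) {v : V} (hv : v ∈ weightSpace ψ σ w') : weightProj ψ σ w v = 0 := by
  rw [weightProj_apply]
  have h : ∀ m : M, ψ (-w m) • σ (Affine.ofVec ρ m) v = ψ ((w' - w) m) • v := fun m => by
    rw [mem_weightSpace.1 hv m, smul_smul, ← AddChar.map_add_eq_mul, LinearMap.sub_apply,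
      neg_add_eq_sub]
  rw [Finset.sum_congr rfl fun m _ => h m, ← Finset.sum_smul,
    sum_addChar_apply hψ (sub_ne_zero.2 hw), zero_smul]

/-- A nonzero subspace stable under translations contains a weight vector. -/
theorem exists_weightSpace_inf_ne_bot [Finite F] [Finite M] (hψ : ψ ≠ 1) {U : Submodule ℂ V}
    (hU : ∀ m, ∀ v ∈ U, σ (Affine.ofVec ρ m) v ∈ U) (h0 : U ≠ ⊥) :
    ∃ w, U ⊓ weightSpace ψ σ w ≠ ⊥ := by
  have := Fintype.ofFinite M
  have := Fintype.ofFinite (Module.Dual F M)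
  obtain ⟨v, hv, hv0⟩ := (Submodule.ne_bot_iff _).1 h0
  by_contra! h
  refine hv0 ((smul_eq_zero.1 (?_ : (Fintype.card (Module.Dual F M) : ℂ) • v = 0)).resolve_left
    (by exact_mod_cast Fintype.card_ne_zero))
  rw [← sum_weightProj (σ := σ) hψ]
  refine Finset.sum_eq_zero fun w _ => ?_
  have h1 : weightProj ψ σ w v ∈ U ⊓ weightSpace ψ σ w := by
    refine ⟨?_, weightProj_mem w v⟩
    rw [weightProj_apply]
    exact sum_mem fun m _ => U.smul_mem _ (hU m v hv)
  rwa [h w, Submodule.mem_bot] at h1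

/-- Weight spaces of different weights are independent. -/
theorem card_mul_le_finrank [Finite F] [Finite M] [FiniteDimensional ℂ V] (hψ : ψ ≠ 1)
    (s : Finset (Module.Dual F M)) {d : ℕ}
    (hd : ∀ w ∈ s, d ≤ Module.finrank ℂ (weightSpace ψ σ w)) :
    s.card * d ≤ Module.finrank ℂ V := by
  have := Fintype.ofFinite M
  let T : (∀ w : s, weightSpace ψ σ (w : Module.Dual F M)) →ₗ[ℂ] V :=
    ∑ w : s, (weightSpace ψ σ (w : Module.Dual F M)).subtype ∘ₗ LinearMap.proj w
  have hT : Function.Injective T := by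
    rw [injective_iff_map_eq_zero]
    intro v hv
    ext w
    have h1 : weightProj ψ σ (w : Module.Dual F M) (T v) = (Fintype.card M : ℂ) • (v w : V) := by
      simp only [T, LinearMap.sum_apply, map_sum]
      rw [Finset.sum_eq_single w]
      · exact weightProj_of_mem (v w).2
      · intro w' _ hw'
        exact weightProj_of_mem_of_ne hψ (fun h => hw' (Subtype.ext h)) (v w').2
      · simp
    rw [hv, map_zero] at h1
    exact (smul_eq_zero.1 h1.symm).resolve_left (by exact_mod_cast Fintype.card_ne_zero)
  have h2 := LinearMap.finrank_le_finrank_of_injective hT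
  rw [Module.finrank_pi_fintype] at h2
  refine le_trans ?_ h2
  have h3 := Finset.card_nsmul_le_sum (Finset.univ : Finset s)
    (fun w => Module.finrank ℂ (weightSpace ψ σ (w : Module.Dual F M))) d fun w _ => hd w w.2
  simpa using h3

/-- The complement `H` permutes the weight spaces as it permutes the weights. -/
theorem apply_ofLin_mem_weightSpace {w : Module.Dual F M} {v : V} (hv : v ∈ weightSpace ψ σ w)
    (h : H) : σ (Affine.ofLin ρ h) v ∈ weightSpace ψ σ (ρ.dual h w) := by
  intro m
  have h1 : Affine.ofVec ρ m * Affine.ofLin ρ h =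
      Affine.ofLin ρ h * Affine.ofVec ρ (ρ h⁻¹ m) := by
    rw [Affine.ofLin_mul_ofVec, self_inv_apply]
  rw [← Module.End.mul_apply, ← map_mul, h1, map_mul, Module.End.mul_apply,
    mem_weightSpace.1 hv, map_smul, dual_apply_apply]

theorem finrank_weightSpace_le [FiniteDimensional ℂ V] (w : Module.Dual F M) (h : H) :
    Module.finrank ℂ (weightSpace ψ σ w) ≤
      Module.finrank ℂ (weightSpace ψ σ (ρ.dual h w)) := by
  have hi := (σ.apply_bijective (Affine.ofLin ρ h)).injective
  refine LinearMap.finrank_le_finrank_of_injective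
    (f := (σ (Affine.ofLin ρ h)).restrict fun v hv => apply_ofLin_mem_weightSpace hv h) ?_
  intro x y hxy
  exact Subtype.ext (hi (congrArg Subtype.val hxy))

/-- The weights of a representation are closed under the action of `H`, with multiplicities. -/
theorem ncard_dualOrbit_mul_finrank_le [Finite F] [Finite M] [FiniteDimensional ℂ V]
    (hψ : ψ ≠ 1) (w : Module.Dual F M) :
    (dualOrbit ρ w).ncard * Module.finrank ℂ (weightSpace ψ σ w) ≤ Module.finrank ℂ V := by
  have hfin : (dualOrbit ρ w).Finite := Set.toFinite _
  rw [Set.ncard_eq_toFinset_card _ hfin]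
  refine card_mul_le_finrank (σ := σ) hψ _ fun w' hw' => ?_
  rw [Set.Finite.mem_toFinset] at hw'
  obtain ⟨h, rfl⟩ := hw'
  exact finrank_weightSpace_le w h

theorem Equiv.apply_mem_weightSpace {τ : Representation ℂ (Affine ρ) W} (e : σ.Equiv τ)
    {w : Module.Dual F M} {v : V} (hv : v ∈ weightSpace ψ σ w) : e v ∈ weightSpace ψ τ w := by
  intro m
  have h1 : e (σ (Affine.ofVec ρ m) v) = τ (Affine.ofVec ρ m) (e v) :=
    IntertwiningMap.isIntertwining _ _ e.toIntertwiningMap _ v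
  rw [← h1, mem_weightSpace.1 hv, map_smul]

end Weight

end Representation

/-! ### Monomial representations of affine groups -/

namespace Representation

section Monomial

variable {F H M : Type*} [Field F] [Group H] [AddCommGroup M] [Module F M]
  {ρ : Representation F H M}

/-- The space of the representation of `M ⋊ H` induced from the linear character `(ψ ∘ w) ⋅ c` of
`M ⋊ T`, where `T` is the stabilizer of `w`: the functions on the complement `H` that transform
under right translation by `T` through `c⁻¹`. -/
def monomialSpace (w : Module.Dual F M) (c : dualStabilizer ρ w →* ℂˣ) : Submodule ℂ (H → ℂ) where
  carrier := {f | ∀ (x : H) (t : dualStabilizer ρ w), f (x * t) = ((c t)⁻¹ : ℂˣ) * f x}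
  zero_mem' x t := by simp
  add_mem' {a b} ha hb x t := by rw [Pi.add_apply, ha, hb, Pi.add_apply, mul_add]
  smul_mem' r f hf x t := by
    rw [Pi.smul_apply, hf, Pi.smul_apply, smul_eq_mul, smul_eq_mul, mul_left_comm]

theorem mem_monomialSpace {w : Module.Dual F M} {c : dualStabilizer ρ w →* ℂˣ} {f : H → ℂ} :
    f ∈ monomialSpace w c ↔
      ∀ (x : H) (t : dualStabilizer ρ w), f (x * t) = ((c t)⁻¹ : ℂˣ) * f x := Iff.rfl

/-- The representation of `M ⋊ H` induced from the linear character `(ψ ∘ w) ⋅ c` of `M ⋊ T`, where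
`T` is the stabilizer of `w`. -/
def monomialRep (ψ : AddChar F ℂ) (w : Module.Dual F M) (c : dualStabilizer ρ w →* ℂˣ) :
    Representation ℂ (Affine ρ) (monomialSpace w c) where
  toFun g :=
    { toFun := fun f => ⟨fun x => ψ (w (ρ x⁻¹ g.vec)) * (f : H → ℂ) (g.lin⁻¹ * x), fun x t => by
        have ht : w (ρ (x * t)⁻¹ g.vec) = w (ρ x⁻¹ g.vec) := by
          rw [mul_inv_rev, map_mul, Module.End.mul_apply,
            apply_of_mem_dualStabilizer (inv_mem t.2)]
        beta_reduce
        rw [ht, ← mul_assoc g.lin⁻¹, mem_monomialSpace.1 f.2, mul_left_comm]⟩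
      map_add' := fun f f' => by
        ext x
        simp [mul_add]
      map_smul' := fun r f => by
        ext x
        simp [mul_left_comm] }
  map_one' := by
    ext f x
    simp
  map_mul' g g' := by
    ext f x
    simp [AddChar.map_add_eq_mul, mul_assoc]

theorem monomialRep_apply (ψ : AddChar F ℂ) (w : Module.Dual F M) (c : dualStabilizer ρ w →* ℂˣ)
    (g : Affine ρ) (f : monomialSpace w c) (x : H) :
    (monomialRep ψ w c g f : H → ℂ) x =
      ψ (w (ρ x⁻¹ g.vec)) * (f : H → ℂ) (g.lin⁻¹ * x) := rfl

open Classical in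
/-- The function in the monomial space that is `c⁻¹` on the stabilizer and `0` elsewhere. -/
noncomputable def monomialVec (w : Module.Dual F M) (c : dualStabilizer ρ w →* ℂˣ) :
    monomialSpace w c :=
  ⟨fun x => if h : x ∈ dualStabilizer ρ w then ((c ⟨x, h⟩)⁻¹ : ℂˣ) else 0, fun x t => by
    beta_reduce
    by_cases hx : x ∈ dualStabilizer ρ w
    · have hxt : x * t ∈ dualStabilizer ρ w := mul_mem hx t.2
      have h1 : (⟨x * t, hxt⟩ : dualStabilizer ρ w) = ⟨x, hx⟩ * t := rfl
      rw [dif_pos hx, dif_pos hxt, h1, map_mul, mul_inv_rev, Units.val_mul]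
    · have hxt : x * t ∉ dualStabilizer ρ w := fun h => hx ((mul_mem_cancel_right t.2).1 h)
      rw [dif_neg hx, dif_neg hxt, mul_zero]⟩

theorem monomialVec_of_mem {w : Module.Dual F M} (c : dualStabilizer ρ w →* ℂˣ)
    (t : dualStabilizer ρ w) : (monomialVec w c : H → ℂ) t = ((c t)⁻¹ : ℂˣ) :=
  dif_pos t.2

theorem monomialVec_of_notMem {w : Module.Dual F M} (c : dualStabilizer ρ w →* ℂˣ) {x : H}
    (hx : x ∉ dualStabilizer ρ w) : (monomialVec w c : H → ℂ) x = 0 :=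
  dif_neg hx

theorem monomialVec_ne_zero (w : Module.Dual F M) (c : dualStabilizer ρ w →* ℂˣ) :
    monomialVec w c ≠ 0 := by
  intro h
  have h1 := monomialVec_of_mem c 1
  rw [h] at h1
  simp at h1

theorem monomialVec_mem_weightSpace (ψ : AddChar F ℂ) (w : Module.Dual F M)
    (c : dualStabilizer ρ w →* ℂˣ) :
    monomialVec w c ∈ weightSpace ψ (monomialRep ψ w c) w := by
  intro m
  ext x
  rw [monomialRep_apply, Affine.vec_ofVec, Affine.lin_ofVec, inv_one, one_mul]
  change _ = ψ (w m) * (monomialVec w c : H → ℂ) x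
  by_cases hx : x ∈ dualStabilizer ρ w
  · rw [apply_of_mem_dualStabilizer (inv_mem hx)]
  · rw [monomialVec_of_notMem c hx, mul_zero, mul_zero]

theorem monomialRep_ofLin_monomialVec (ψ : AddChar F ℂ) (w : Module.Dual F M)
    (c : dualStabilizer ρ w →* ℂˣ) (t : dualStabilizer ρ w) :
    monomialRep ψ w c (Affine.ofLin ρ t) (monomialVec w c) = (c t : ℂ) • monomialVec w c := by
  ext x
  rw [monomialRep_apply, Affine.vec_ofLin, Affine.lin_ofLin, map_zero, map_zero,
    AddChar.map_zero_eq_one, one_mul]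
  change _ = (c t : ℂ) * (monomialVec w c : H → ℂ) x
  by_cases hx : x ∈ dualStabilizer ρ w
  · have h1 := monomialVec_of_mem c (t⁻¹ * ⟨x, hx⟩)
    have h2 := monomialVec_of_mem c ⟨x, hx⟩
    simp only [Subgroup.coe_mul, InvMemClass.coe_inv] at h1 h2
    rw [h1, h2, ← Units.val_mul, map_mul, map_inv, mul_inv_rev, inv_inv, mul_comm]
  · rw [monomialVec_of_notMem c hx, monomialVec_of_notMem c, mul_zero]
    exact fun h => hx ((mul_mem_cancel_left (inv_mem t.2)).1 h)

theorem finrank_monomialSpace_le [Finite H] (w : Module.Dual F M) (c : dualStabilizer ρ w →* ℂˣ) :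
    Module.finrank ℂ (monomialSpace w c) ≤ (dualOrbit ρ w).ncard := by
  have := Fintype.ofFinite (H ⧸ dualStabilizer ρ w)
  rw [← index_dualStabilizer, Subgroup.index, Nat.card_eq_fintype_card,
    ← Module.finrank_fintype_fun_eq_card ℂ]
  let T : monomialSpace w c →ₗ[ℂ] (H ⧸ dualStabilizer ρ w → ℂ) :=
    LinearMap.funLeft ℂ ℂ Quotient.out ∘ₗ (monomialSpace w c).subtype
  refine LinearMap.finrank_le_finrank_of_injective (f := T) ?_
  rw [injective_iff_map_eq_zero]
  intro f hf
  ext x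
  obtain ⟨t, ht⟩ := QuotientGroup.mk_out_eq_mul (dualStabilizer ρ w) x
  have h1 : (f : H → ℂ) (x * t) = 0 := by
    rw [← ht]
    exact congrFun hf (x : H ⧸ dualStabilizer ρ w)
  rw [mem_monomialSpace.1 f.2] at h1
  exact (mul_eq_zero.1 h1).resolve_left (Units.ne_zero _)

theorem finrank_weightSpace_pos {V : Type*} [AddCommGroup V] [Module ℂ V] [FiniteDimensional ℂ V]
    {ψ : AddChar F ℂ} {σ : Representation ℂ (Affine ρ) V} {w : Module.Dual F M} {v : V}
    (hv : v ∈ weightSpace ψ σ w) (h0 : v ≠ 0) : 0 < Module.finrank ℂ (weightSpace ψ σ w) :=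
  Module.finrank_pos_iff.2 ⟨⟨⟨v, hv⟩, 0, fun h => h0 (congrArg Subtype.val h)⟩⟩

theorem ncard_dualOrbit_pos [Finite F] [Finite M] (ρ : Representation F H M) (w : Module.Dual F M) :
    0 < (dualOrbit ρ w).ncard :=
  (Set.ncard_pos (Set.toFinite _)).2 (Set.range_nonempty _)

variable {ψ : AddChar F ℂ} [Finite F] [Finite M]

/-- If the dimension does not exceed the length of the orbit of a weight, the weight space is a
line. -/
theorem finrank_weightSpace_eq_one {V : Type*} [AddCommGroup V] [Module ℂ V]
    [FiniteDimensional ℂ V] (hψ : ψ ≠ 1) {σ : Representation ℂ (Affine ρ) V}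
    {w : Module.Dual F M} {v : V} (hv : v ∈ weightSpace ψ σ w) (h0 : v ≠ 0)
    (hV : Module.finrank ℂ V ≤ (dualOrbit ρ w).ncard) :
    Module.finrank ℂ (weightSpace ψ σ w) = 1 := by
  refine le_antisymm ?_ (finrank_weightSpace_pos hv h0)
  have h1 := (ncard_dualOrbit_mul_finrank_le (σ := σ) hψ w).trans hV
  exact Nat.le_of_mul_le_mul_left (h1.trans (mul_one _).ge) (ncard_dualOrbit_pos ρ w)

theorem exists_smul_eq_of_mem_weightSpace {V : Type*} [AddCommGroup V] [Module ℂ V]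
    [FiniteDimensional ℂ V] (hψ : ψ ≠ 1) {σ : Representation ℂ (Affine ρ) V}
    {w : Module.Dual F M} {v v' : V} (hv : v ∈ weightSpace ψ σ w) (h0 : v ≠ 0)
    (hV : Module.finrank ℂ V ≤ (dualOrbit ρ w).ncard) (hv' : v' ∈ weightSpace ψ σ w) :
    ∃ a : ℂ, a • v = v' := by
  obtain ⟨a, ha⟩ := (finrank_eq_one_iff_of_nonzero' (⟨v, hv⟩ : weightSpace ψ σ w)
    (fun h => h0 (congrArg Subtype.val h))).1 (finrank_weightSpace_eq_one hψ hv h0 hV) ⟨v', hv'⟩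
  exact ⟨a, congrArg Subtype.val ha⟩

/-- All weights of a monomial representation lie in one orbit. -/
theorem exists_dual_eq_of_mem_weightSpace (hψ : ψ ≠ 1) {w w' : Module.Dual F M}
    {c : dualStabilizer ρ w →* ℂˣ} {f : monomialSpace w c}
    (hf : f ∈ weightSpace ψ (monomialRep ψ w c) w') (h0 : f ≠ 0) :
    ∃ h, w' = ρ.dual h w := by
  obtain ⟨x, hx⟩ : ∃ x, (f : H → ℂ) x ≠ 0 := by
    by_contra! h
    exact h0 (Subtype.ext (funext h))
  refine ⟨x, eq_of_addChar_apply_eq hψ fun m => ?_⟩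
  have h2 := congrFun (congrArg Subtype.val (hf m)) x
  rw [monomialRep_apply, Affine.vec_ofVec, Affine.lin_ofVec, inv_one, one_mul] at h2
  exact (mul_right_cancel₀ hx h2).symm

variable [Finite H]

/-- The upper bound comes from restricting functions to coset representatives, the lower bound from
the presence of the weight `w`. -/
theorem finrank_monomialSpace (hψ : ψ ≠ 1) (w : Module.Dual F M)
    (c : dualStabilizer ρ w →* ℂˣ) :
    Module.finrank ℂ (monomialSpace w c) = (dualOrbit ρ w).ncard := by
  refine le_antisymm (finrank_monomialSpace_le w c) ?_
  refine le_trans ?_ (ncard_dualOrbit_mul_finrank_le (σ := monomialRep ψ w c) hψ w)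
  exact Nat.le_mul_of_pos_right _
    (finrank_weightSpace_pos (monomialVec_mem_weightSpace ψ w c) (monomialVec_ne_zero w c))

/-- A nonzero subrepresentation has all weights of the orbit, so it is too large to be proper. -/
theorem monomialRep_isIrreducible (hψ : ψ ≠ 1) (w : Module.Dual F M)
    (c : dualStabilizer ρ w →* ℂˣ) : (monomialRep ψ w c).IsIrreducible := by
  rw [isIrreducible_iff_forall_submodule]
  refine ⟨⟨⟨monomialVec w c, 0, monomialVec_ne_zero w c⟩⟩, fun U hU => ?_⟩
  rw [or_iff_not_imp_left]
  intro h0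
  obtain ⟨w', hw'⟩ := exists_weightSpace_inf_ne_bot hψ (fun m v hv => hU _ v hv) h0
  obtain ⟨f, ⟨hfU, hfw⟩, hf0⟩ := (Submodule.ne_bot_iff _).1 hw'
  obtain ⟨h, rfl⟩ := exists_dual_eq_of_mem_weightSpace hψ hfw hf0
  -- The restriction to `U` has the weight `w`, so its dimension is at least the orbit length.
  let τ : Representation ℂ (Affine ρ) U :=
    (⟨U, fun g v hv => hU g v hv⟩ : Subrepresentation (monomialRep ψ w c)).toRepresentation
  have h1 := apply_ofLin_mem_weightSpace hfw h⁻¹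
  rw [inv_self_apply] at h1
  let u : U := ⟨monomialRep ψ w c (Affine.ofLin ρ h⁻¹) f, hU _ _ hfU⟩
  have hu : u ∈ weightSpace ψ τ w := fun m => Subtype.ext (h1 m)
  have hu0 : u ≠ 0 := by
    intro h2
    have h3 : monomialRep ψ w c (Affine.ofLin ρ h⁻¹) f = 0 := congrArg Subtype.val h2
    refine hf0 (((monomialRep ψ w c).apply_bijective (Affine.ofLin ρ h⁻¹)).injective ?_)
    rw [h3, map_zero]
  have h4 := ncard_dualOrbit_mul_finrank_le (V := U) (σ := τ) hψ w
  refine Submodule.eq_top_of_finrank_eq (le_antisymm (Submodule.finrank_le U) ?_)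
  rw [finrank_monomialSpace hψ]
  exact le_trans (Nat.le_mul_of_pos_right _ (finrank_weightSpace_pos hu hu0)) h4

/-- The linear character of the stabilizer can be read off from its action on the weight line. -/
theorem monomialRep_character_injective (hψ : ψ ≠ 1) {w : Module.Dual F M}
    {c c' : dualStabilizer ρ w →* ℂˣ}
    (h : (monomialRep ψ w c).character = (monomialRep ψ w c').character) : c = c' := by
  obtain ⟨e⟩ := nonempty_equiv_of_character_eq (monomialRep_isIrreducible hψ w c)
    (monomialRep_isIrreducible hψ w c') h
  have h1 := e.apply_mem_weightSpace (monomialVec_mem_weightSpace ψ w c)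
  have h0 : e (monomialVec w c) ≠ 0 := fun h2 =>
    monomialVec_ne_zero w c (e.toLinearEquiv.injective (h2.trans (map_zero e.toLinearEquiv).symm))
  obtain ⟨a, ha⟩ := exists_smul_eq_of_mem_weightSpace hψ (monomialVec_mem_weightSpace ψ w c')
    (monomialVec_ne_zero w c') (finrank_monomialSpace_le w c') h1
  ext t
  have h2 : e (monomialRep ψ w c (Affine.ofLin ρ t) (monomialVec w c)) =
      monomialRep ψ w c' (Affine.ofLin ρ t) (e (monomialVec w c)) :=
    IntertwiningMap.isIntertwining _ _ e.toIntertwiningMap _ _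
  have h3 : e ((c t : ℂ) • monomialVec w c) = (c t : ℂ) • e (monomialVec w c) :=
    map_smul e.toLinearEquiv _ _
  have h4 : monomialRep ψ w c' (Affine.ofLin ρ t) (e (monomialVec w c)) =
      (c' t : ℂ) • e (monomialVec w c) := by
    rw [← ha, map_smul, monomialRep_ofLin_monomialVec, smul_comm]
  rw [monomialRep_ofLin_monomialVec, h3, h4] at h2
  exact smul_left_injective ℂ h0 h2

/-- An irreducible representation whose dimension is the length of the orbit of one of its weights
is monomial. -/
theorem exists_character_eq_monomialRep {V : Type*} [AddCommGroup V] [Module ℂ V]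
    [FiniteDimensional ℂ V] (hψ : ψ ≠ 1) {σ : Representation ℂ (Affine ρ) V}
    (hσ : σ.IsIrreducible) {w : Module.Dual F M} {v : V} (hv : v ∈ weightSpace ψ σ w) (h0 : v ≠ 0)
    (hV : Module.finrank ℂ V ≤ (dualOrbit ρ w).ncard) :
    ∃ c : dualStabilizer ρ w →* ℂˣ, (monomialRep ψ w c).character = σ.character := by
  have h1 : ∀ t : dualStabilizer ρ w, ∃ a : ℂ, a • v = σ (Affine.ofLin ρ t) v := by
    intro t
    refine exists_smul_eq_of_mem_weightSpace hψ hv h0 hV ?_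
    have h2 := apply_ofLin_mem_weightSpace hv (t : H)
    rwa [mem_dualStabilizer.1 t.2] at h2
  choose a ha using h1
  let c₀ : dualStabilizer ρ w →* ℂ :=
    { toFun := a
      map_one' := smul_left_injective ℂ h0 (by
        change a 1 • v = (1 : ℂ) • v
        rw [ha, OneMemClass.coe_one, map_one, map_one, one_smul, Module.End.one_apply])
      map_mul' := fun s t => smul_left_injective ℂ h0 (by
        change a (s * t) • v = (a s * a t) • v
        rw [ha, Subgroup.coe_mul, map_mul, map_mul, Module.End.mul_apply, ← ha t, map_smul, ← ha s,
          smul_smul, mul_comm]) }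
  let c : dualStabilizer ρ w →* ℂˣ := c₀.toHomUnits
  have hc : ∀ t, (c t : ℂ) • v = σ (Affine.ofLin ρ t) v := ha
  have := Fintype.ofFinite H
  -- The intertwining map furnished by Frobenius reciprocity.
  obtain ⟨T, hT⟩ : ∃ T : monomialSpace w c →ₗ[ℂ] V, ∀ f : monomialSpace w c,
      T f = ∑ x : H, (f : H → ℂ) x • σ (Affine.ofLin ρ x) v :=
    ⟨(∑ x : H, (LinearMap.proj x : (H → ℂ) →ₗ[ℂ] ℂ).smulRight (σ (Affine.ofLin ρ x) v)) ∘ₗ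
      (monomialSpace w c).subtype, fun f => by simp⟩
  let Φ : IntertwiningMap (monomialRep ψ w c) σ := ⟨T, fun g => by
    ext f
    rw [LinearMap.comp_apply, LinearMap.comp_apply, hT, hT, map_sum]
    refine Fintype.sum_equiv (Equiv.mulLeft g.lin⁻¹) _ _ fun x => ?_
    rw [monomialRep_apply, map_smul, Equiv.coe_mulLeft, ← Module.End.mul_apply, ← map_mul]
    have h3 : g * Affine.ofLin ρ (g.lin⁻¹ * x) =
        Affine.ofLin ρ x * Affine.ofVec ρ (ρ x⁻¹ g.vec) := by
      ext <;> simp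
    rw [h3, map_mul, Module.End.mul_apply, mem_weightSpace.1 hv, map_smul, smul_smul, mul_comm]⟩
  have hΦ : Φ ≠ 0 := by
    intro h2
    have h3 : T (monomialVec w c) = 0 := by
      change Φ (monomialVec w c) = 0
      rw [h2]
      rfl
    have h4 : T (monomialVec w c) = (Nat.card (dualStabilizer ρ w) : ℂ) • v := by
      classical
      rw [hT, ← Finset.sum_subset (Finset.subset_univ
        (Finset.univ.filter fun x => x ∈ dualStabilizer ρ w))]
      · rw [Finset.sum_congr rfl (g := fun _ => v), Finset.sum_const, Nat.cast_smul_eq_nsmul,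
          Nat.card_eq_fintype_card, Fintype.card_subtype]
        intro x hx
        have hx' : x ∈ dualStabilizer ρ w := (Finset.mem_filter.1 hx).2
        have h5 := monomialVec_of_mem c ⟨x, hx'⟩
        have h6 := hc ⟨x, hx'⟩
        simp only at h5 h6
        rw [h5, ← h6, smul_smul, Units.inv_mul, one_smul]
      · intro x _ hx
        rw [monomialVec_of_notMem c (fun h => hx (Finset.mem_filter.2 ⟨Finset.mem_univ _, h⟩)),
          zero_smul]
    rw [h4] at h3
    refine h0 ((smul_eq_zero.1 h3).resolve_left ?_)
    exact_mod_cast Nat.card_pos.ne'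
  have hirr := monomialRep_isIrreducible hψ w c
  exact ⟨c, char_iso (Φ.ofBijective ((IsIrreducible.bijective_or_eq_zero Φ).resolve_right hΦ))⟩

end Monomial

end Representation

/-! ### Counting the irreducible characters of an affine group -/

namespace Representation

section Twist

variable {F H M : Type*} [Field F] [Group H] [AddCommGroup M] [Module F M]
  {ρ : Representation F H M} {V : Type*} [AddCommGroup V] [Module ℂ V]

/-- The representation of `M ⋊ H` in which `H` acts through `τ` and the translation by `m` acts as
the scalar `ψ (w m)`, for a linear form `w` fixed by `H`. -/
def twistRep (ψ : AddChar F ℂ) (w : ρ.dual.invariants) (τ : Representation ℂ H V) :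
    Representation ℂ (Affine ρ) V where
  toFun g := ψ ((w : Module.Dual F M) g.vec) • τ g.lin
  map_one' := by
    rw [Affine.vec_one, Affine.lin_one, map_zero, AddChar.map_zero_eq_one, map_one, one_smul]
  map_mul' g g' := by
    rw [Affine.vec_mul, Affine.lin_mul, map_add, mem_invariants_dual.1 w.2, AddChar.map_add_eq_mul,
      map_mul, smul_mul_smul_comm]

theorem twistRep_apply (ψ : AddChar F ℂ) (w : ρ.dual.invariants) (τ : Representation ℂ H V)
    (g : Affine ρ) (v : V) :
    twistRep ψ w τ g v = ψ ((w : Module.Dual F M) g.vec) • τ g.lin v := rfl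

/-- The character of `twistRep ψ w τ` in terms of the character of `τ`. -/
def twistChar (ψ : AddChar F ℂ) (w : Module.Dual F M) (χ : H → ℂ) : Affine ρ → ℂ :=
  fun g => ψ (w g.vec) * χ g.lin

theorem twistRep_character (ψ : AddChar F ℂ) (w : ρ.dual.invariants) (τ : Representation ℂ H V) :
    (twistRep ψ w τ).character = twistChar ψ w τ.character := by
  ext g
  exact map_smul (LinearMap.trace ℂ V) _ _

theorem twistRep_isIrreducible (ψ : AddChar F ℂ) (w : ρ.dual.invariants)
    {τ : Representation ℂ H V} (hτ : τ.IsIrreducible) : (twistRep ψ w τ).IsIrreducible := by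
  rw [isIrreducible_iff_forall_submodule] at hτ ⊢
  refine ⟨hτ.1, fun U hU => hτ.2 U fun h v hv => ?_⟩
  have h1 := hU (Affine.ofLin ρ h) v hv
  rwa [twistRep_apply, Affine.vec_ofLin, map_zero, AddChar.map_zero_eq_one, one_smul] at h1

theorem mem_weightSpace_twistRep (ψ : AddChar F ℂ) (w : ρ.dual.invariants)
    (τ : Representation ℂ H V) (v : V) : v ∈ weightSpace ψ (twistRep ψ w τ) w := by
  intro m
  rw [twistRep_apply, Affine.vec_ofVec, Affine.lin_ofVec, map_one, Module.End.one_apply]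

theorem mem_weightSpace_of_isIrreducible {ψ : AddChar F ℂ} {σ : Representation ℂ (Affine ρ) V}
    (hσ : σ.IsIrreducible) (w : ρ.dual.invariants) {v : V}
    (hv : v ∈ weightSpace ψ σ (w : Module.Dual F M)) (h0 : v ≠ 0) (v' : V) :
    v' ∈ weightSpace ψ σ (w : Module.Dual F M) := by
  have h1 : weightSpace ψ σ (w : Module.Dual F M) = ⊤ := by
    refine hσ.eq_top (fun g u hu => ?_) ((Submodule.ne_bot_iff _).2 ⟨v, hv, h0⟩)
    rw [← Affine.ofVec_vec_mul_ofLin_lin g, map_mul, Module.End.mul_apply]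
    have h2 := apply_ofLin_mem_weightSpace hu g.lin
    rw [w.2] at h2
    rw [mem_weightSpace.1 h2]
    exact Submodule.smul_mem _ _ h2
  rw [h1]
  trivial

/-- An irreducible representation of `M ⋊ H` with a fixed weight is obtained from an irreducible
representation of `H`. -/
theorem exists_eq_twistRep {ψ : AddChar F ℂ} {σ : Representation ℂ (Affine ρ) V}
    (hσ : σ.IsIrreducible) (w : ρ.dual.invariants) {v : V}
    (hv : v ∈ weightSpace ψ σ (w : Module.Dual F M)) (h0 : v ≠ 0) :
    ∃ τ : Representation ℂ H V, τ.IsIrreducible ∧ twistRep ψ w τ = σ := by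
  have h1 := mem_weightSpace_of_isIrreducible hσ w hv h0
  let τ : Representation ℂ H V := MonoidHom.comp σ (Affine.ofLin ρ)
  have h2 : ∀ g u, σ g u = ψ ((w : Module.Dual F M) g.vec) • τ g.lin u := by
    intro g u
    rw [← Affine.ofVec_vec_mul_ofLin_lin g, map_mul, Module.End.mul_apply]
    rw [mem_weightSpace.1 (h1 _)]
    simp [τ]
  refine ⟨τ, ?_, ?_⟩
  · rw [isIrreducible_iff_forall_submodule] at hσ ⊢
    refine ⟨hσ.1, fun U hU => hσ.2 U fun g u hu => ?_⟩
    rw [h2]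
    exact U.smul_mem _ (hU _ _ hu)
  · ext g u
    rw [twistRep_apply, h2]

end Twist

section Count

variable {F H M : Type*} [Field F] [Finite F] [Group H] [Finite H] [AddCommGroup M] [Module F M]
  [Finite M]

/-- The number of irreducible characters of degree `k` of `M ⋊ H`, when every `H`-orbit of linear
forms on `M` is a fixed point, or has more than `k` elements, or has exactly `k` elements and a
unique representative in `R`. An orbit of length greater than `k` contributes nothing, since the
dimension of a representation is at least the length of the orbit of any of its weights. -/
theorem numIrrCharacters_affine (ρ : Representation F H M) {k : ℕ} (hk : 2 ≤ k)
    (R : Set (Module.Dual F M)) (hR : ∀ w ∈ R, (dualOrbit ρ w).ncard = k)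
    (hinj : ∀ w ∈ R, ∀ h, ρ.dual h w ∈ R → ρ.dual h w = w)
    (hcov : ∀ w, w ∈ ρ.dual.invariants ∨ k < (dualOrbit ρ w).ncard ∨ ∃ h, ρ.dual h w ∈ R) :
    numIrrCharacters k (Affine ρ) =
      Nat.card ρ.dual.invariants * numIrrCharacters k H +
        Nat.card (Σ w : R, (dualStabilizer ρ (w : Module.Dual F M) →* ℂˣ)) := by
  obtain ⟨ψ, hψ1⟩ := AddChar.exists_apply_ne_zero.2 (one_ne_zero (α := F))
  have hψ : ψ ≠ 1 := AddChar.ne_one_iff.2 ⟨1, hψ1⟩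
  let Θ : (Module.Dual F M) × (H → ℂ) → (Affine ρ → ℂ) := fun p => twistChar ψ p.1 p.2
  let I : Set ((Module.Dual F M) × (H → ℂ)) :=
    (ρ.dual.invariants : Set (Module.Dual F M)) ×ˢ {χ | χ ∈ irrCharacters H ∧ χ 1 = (k : ℂ)}
  let Ψ : (Σ w : R, (dualStabilizer ρ (w : Module.Dual F M) →* ℂˣ)) → (Affine ρ → ℂ) :=
    fun p => (monomialRep ψ (p.1 : Module.Dual F M) p.2).character
  have hΘ : Set.InjOn Θ I := by
    rintro ⟨w, χ⟩ ⟨-, -, hχ⟩ ⟨w', χ'⟩ ⟨-, -, hχ'⟩ h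
    simp only at hχ hχ'
    have h1 : ∀ g : Affine ρ, ψ (w g.vec) * χ g.lin = ψ (w' g.vec) * χ' g.lin := congrFun h
    have hw : w = w' := by
      refine eq_of_addChar_apply_eq hψ fun m => ?_
      have h2 := h1 (Affine.ofVec ρ m)
      rw [Affine.lin_ofVec, hχ, hχ'] at h2
      refine mul_right_cancel₀ ?_ h2
      exact_mod_cast (by omega : k ≠ 0)
    subst hw
    refine Prod.ext rfl (funext fun x => ?_)
    exact mul_left_cancel₀ (AddChar.val_isUnit ψ _).ne_zero (h1 (Affine.ofLin ρ x))
  have hΨ : Function.Injective Ψ := by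
    rintro ⟨⟨w, hw⟩, c⟩ ⟨⟨w', hw'⟩, c'⟩ h
    have hww : w' = w := by
      obtain ⟨e⟩ := nonempty_equiv_of_character_eq (monomialRep_isIrreducible hψ w c)
        (monomialRep_isIrreducible hψ w' c') h
      have h1 := e.symm.apply_mem_weightSpace (monomialVec_mem_weightSpace ψ w' c')
      obtain ⟨x, hx⟩ := exists_dual_eq_of_mem_weightSpace hψ h1 fun h2 =>
        monomialVec_ne_zero w' c' (e.symm.toLinearEquiv.injective
          (h2.trans (map_zero e.symm.toLinearEquiv).symm))
      rw [hx]
      exact hinj w hw x (hx ▸ hw')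
    subst hww
    exact Sigma.ext rfl (heq_of_eq (monomialRep_character_injective hψ h))
  have hunion : {χ : Affine ρ → ℂ | χ ∈ irrCharacters (Affine ρ) ∧ χ 1 = (k : ℂ)} =
      Θ '' I ∪ Set.range Ψ := by
    ext χ
    constructor
    · rintro ⟨h, h1⟩
      obtain ⟨σ, hσ, rfl⟩ := exists_of_mem_irrCharacters h h1
      have := hσ.nontrivial
      obtain ⟨w, hw⟩ := exists_weightSpace_inf_ne_bot (ρ := ρ) (σ := σ) hψ
        (fun m v _ => Submodule.mem_top) top_ne_bot
      obtain ⟨v, ⟨-, hv⟩, h0⟩ := (Submodule.ne_bot_iff _).1 hw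
      rcases hcov w with hw | hw | ⟨x, hx⟩
      · left
        obtain ⟨τ, hτ, hτσ⟩ := exists_eq_twistRep hσ ⟨w, hw⟩ hv h0
        refine ⟨(w, τ.character), ⟨hw, hτ.character_mem_irrCharacters, ?_⟩, ?_⟩
        · simp
        · rw [← hτσ, twistRep_character]
      · have h2 := ncard_dualOrbit_mul_finrank_le (σ := σ) hψ w
        rw [Module.finrank_fin_fun] at h2
        have h3 := Nat.le_mul_of_pos_right (dualOrbit ρ w).ncard (finrank_weightSpace_pos hv h0)
        omega
      · right
        have h0' : σ (Affine.ofLin ρ x) v ≠ 0 := fun h2 =>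
          h0 ((σ.apply_bijective _).injective (h2.trans (map_zero _).symm))
        obtain ⟨c, hc⟩ := exists_character_eq_monomialRep hψ hσ
          (apply_ofLin_mem_weightSpace hv x) h0' (by rw [Module.finrank_fin_fun, hR _ hx])
        exact ⟨⟨⟨_, hx⟩, c⟩, hc⟩
    · rintro (⟨⟨w, χ⟩, ⟨hw, h, h1⟩, rfl⟩ | ⟨⟨⟨w, hw⟩, c⟩, rfl⟩)
      · obtain ⟨τ, hτ, rfl⟩ := exists_of_mem_irrCharacters h h1
        have h2 := twistRep_character ψ ⟨w, hw⟩ τ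
        change twistChar ψ w τ.character ∈ _ ∧ twistChar ψ w τ.character 1 = _
        rw [← h2]
        refine ⟨(twistRep_isIrreducible ψ _ hτ).character_mem_irrCharacters, ?_⟩
        simp
      · refine ⟨(monomialRep_isIrreducible hψ w c).character_mem_irrCharacters, ?_⟩
        change (monomialRep ψ w c).character 1 = _
        rw [char_one, finrank_monomialSpace hψ, hR w hw]
  have hdisj : Disjoint (Θ '' I) (Set.range Ψ) := by
    rw [Set.disjoint_left]
    rintro _ ⟨⟨w, χ⟩, ⟨hw, h, h1⟩, rfl⟩ ⟨⟨⟨w', hw'⟩, c⟩, hc⟩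
    obtain ⟨τ, hτ, rfl⟩ := exists_of_mem_irrCharacters h h1
    have h2 := twistRep_character ψ ⟨w, hw⟩ τ
    obtain ⟨e⟩ := nonempty_equiv_of_character_eq (twistRep_isIrreducible ψ ⟨w, hw⟩ hτ)
      (monomialRep_isIrreducible hψ w' c) (h2.trans hc.symm)
    have := hτ.nontrivial
    obtain ⟨v, hv⟩ := exists_ne (0 : Fin k → ℂ)
    obtain ⟨x, hx⟩ := exists_dual_eq_of_mem_weightSpace hψ
      (e.apply_mem_weightSpace (mem_weightSpace_twistRep ψ ⟨w, hw⟩ τ v)) fun h3 =>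
        hv (e.toLinearEquiv.injective (h3.trans (map_zero e.toLinearEquiv).symm))
    -- A weight in `R` would then be fixed, so that its orbit has length `1`.
    have h4 : w' = w := by
      have h5 : w' = ρ.dual x⁻¹ w := by
        rw [show w = ρ.dual x w' from hx, inv_self_apply]
      rw [h5, hw]
    subst h4
    have h6 : dualOrbit ρ w' = {w'} := by
      ext u
      exact ⟨fun ⟨y, hy⟩ => hy.symm.trans (hw y), fun hu => ⟨1, by rw [hu]; exact hw 1⟩⟩
    have h7 := hR w' hw'
    rw [h6, Set.ncard_singleton] at h7
    omega
  have hfin := (finite_irrCharacters (Affine ρ)).subset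
    (fun _ h => h.1 : {χ : Affine ρ → ℂ | χ ∈ irrCharacters (Affine ρ) ∧ χ 1 = (k : ℂ)} ⊆ _)
  rw [hunion] at hfin
  rw [numIrrCharacters, hunion, Set.ncard_union_eq hdisj (hfin.subset Set.subset_union_left)
    (hfin.subset Set.subset_union_right), hΘ.ncard_image, Set.ncard_prod,
    ← Nat.card_coe_set_eq (Set.range Ψ), Nat.card_congr (Equiv.ofInjective Ψ hΨ).symm]
  rfl

end Count

end Representation

namespace Representation

/-! ### Linear characters of an affine group -/

section LinearCharacter

theorem finite_monoidHom_units (G : Type*) [Group G] [Finite G] : Finite (G →* ℂˣ) := by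
  have h1 : Finite (G →* ℂ) := (linearIndependent_monoidHom G ℂ).finite
  refine Finite.of_injective (fun c : G →* ℂˣ => (Units.coeHom ℂ).comp c) fun c c' h => ?_
  ext x
  exact DFunLike.congr_fun h x

variable {F H M : Type*} [Field F] [Finite F] [Group H] [AddCommGroup M] [Module F M]
  [Finite M] {ρ : Representation F H M}

/-- Every linear character of `M ⋊ H` is given on translations by a linear form. -/
theorem exists_dual_apply_eq {ψ : AddChar F ℂ} (hψ : ψ ≠ 1) (θ : Affine ρ →* ℂˣ) :
    ∃ w : Module.Dual F M, ∀ m, (θ (Affine.ofVec ρ m) : ℂ) = ψ (w m) := by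
  let σ : Representation ℂ (Affine ρ) ℂ :=
    (Algebra.lmul ℂ ℂ : ℂ →* Module.End ℂ ℂ).comp ((Units.coeHom ℂ).comp θ)
  obtain ⟨w, hw⟩ := exists_weightSpace_inf_ne_bot (ρ := ρ) (σ := σ) hψ
    (fun m v _ => Submodule.mem_top) top_ne_bot
  obtain ⟨v, ⟨-, hv⟩, h0⟩ := (Submodule.ne_bot_iff _).1 hw
  exact ⟨w, fun m => mul_right_cancel₀ h0 (hv m)⟩

/-- A linear character of `M ⋊ H` amounts to a linear form on `M` fixed by `H` together with a
linear character of `H`. -/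
theorem card_affine_monoidHom_units (ρ : Representation F H M) :
    Nat.card (Affine ρ →* ℂˣ) = Nat.card ρ.dual.invariants * Nat.card (H →* ℂˣ) := by
  obtain ⟨ψ, hψ1⟩ := AddChar.exists_apply_ne_zero.2 (one_ne_zero (α := F))
  have hψ : ψ ≠ 1 := AddChar.ne_one_iff.2 ⟨1, hψ1⟩
  let Φ : ρ.dual.invariants × (H →* ℂˣ) → (Affine ρ →* ℂˣ) := fun p =>
    MonoidHom.toHomUnits
      { toFun := fun g => ψ ((p.1 : Module.Dual F M) g.vec) * (p.2 g.lin : ℂ)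
        map_one' := by simp
        map_mul' := fun g g' => by
          rw [Affine.vec_mul, Affine.lin_mul, map_add, mem_invariants_dual.1 p.1.2,
            AddChar.map_add_eq_mul, map_mul, Units.val_mul]
          ring }
  have hΦ : ∀ p (g : Affine ρ), (Φ p g : ℂ) = ψ ((p.1 : Module.Dual F M) g.vec) * (p.2 g.lin : ℂ) :=
    fun _ _ => rfl
  rw [← Nat.card_prod]
  refine (Nat.card_congr (Equiv.ofBijective Φ ⟨?_, ?_⟩)).symm
  · rintro ⟨⟨w, hw⟩, c⟩ ⟨⟨w', hw'⟩, c'⟩ h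
    have h1 : ∀ g : Affine ρ,
        ψ (w g.vec) * (c g.lin : ℂ) = ψ (w' g.vec) * (c' g.lin : ℂ) := fun g => by
      have h2 := hΦ ⟨⟨w, hw⟩, c⟩ g
      rw [h] at h2
      exact h2.symm.trans (hΦ ⟨⟨w', hw'⟩, c'⟩ g)
    have hww : w = w' := eq_of_addChar_apply_eq hψ fun m => by
      simpa using h1 (Affine.ofVec ρ m)
    subst hww
    refine Prod.ext rfl (MonoidHom.ext fun x => Units.ext ?_)
    simpa using h1 (Affine.ofLin ρ x)
  · intro θ
    obtain ⟨w, hw⟩ := exists_dual_apply_eq hψ θ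
    have hinv : w ∈ ρ.dual.invariants := by
      rw [mem_invariants_dual]
      intro h
      refine LinearMap.congr_fun (f := w ∘ₗ ρ h) (eq_of_addChar_apply_eq hψ fun m => ?_)
      have h1 := congrArg θ (Affine.ofLin_mul_ofVec (ρ := ρ) m h)
      rw [map_mul, map_mul, mul_comm] at h1
      rw [LinearMap.comp_apply, ← hw, ← hw, mul_right_cancel h1]
    refine ⟨⟨⟨w, hinv⟩, θ.comp (Affine.ofLin ρ)⟩, MonoidHom.ext fun g => Units.ext ?_⟩
    rw [hΦ]
    change ψ (w g.vec) * (θ (Affine.ofLin ρ g.lin) : ℂ) = _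
    rw [← hw, ← Units.val_mul, ← map_mul, Affine.ofVec_vec_mul_ofLin_lin]

end LinearCharacter

/-! ### The affine group acting on the homogenized space -/

section AffineRep

variable {F H M : Type*} [Field F] [Group H] [AddCommGroup M] [Module F M]

/-- The linear action of `M ⋊ H` on `M × F` that extends its affine action on `M`, embedded in
`M × F` as `M × {1}`. -/
def affineRep (ρ : Representation F H M) : Representation F (Affine ρ) (M × F) where
  toFun g :=
    { toFun := fun x => (ρ g.lin x.1 + x.2 • g.vec, x.2)
      map_add' := fun x y => by
        ext
        · simp [add_smul]; abel
        · simp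
      map_smul' := fun c x => by ext <;> simp [mul_smul] }
  map_one' := by ext <;> simp
  map_mul' g g' := by
    refine LinearMap.ext fun x => Prod.ext ?_ rfl
    simp [add_assoc, add_comm (x.2 • g.vec)]

theorem affineRep_apply (ρ : Representation F H M) (g : Affine ρ) (x : M × F) :
    affineRep ρ g x = (ρ g.lin x.1 + x.2 • g.vec, x.2) := rfl

/-- The linear form `(x, t) ↦ u x + t d` on `M × F`. -/
def extendForm (u : Module.Dual F M) (d : F) : Module.Dual F (M × F) :=
  u.coprod (d • LinearMap.id)

@[simp] theorem extendForm_apply (u : Module.Dual F M) (d : F) (x : M × F) :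
    extendForm u d x = u x.1 + d * x.2 := rfl

theorem extendForm_inj {u u' : Module.Dual F M} {d d' : F} :
    extendForm u d = extendForm u' d' ↔ u = u' ∧ d = d' := by
  refine ⟨fun h => ⟨LinearMap.ext fun x => ?_, ?_⟩, fun h => by rw [h.1, h.2]⟩
  · simpa using LinearMap.congr_fun h (x, 0)
  · simpa using LinearMap.congr_fun h (0, 1)

theorem exists_eq_extendForm (w : Module.Dual F (M × F)) : ∃ u d, w = extendForm u d := by
  refine ⟨w ∘ₗ LinearMap.inl F M F, w (0, 1), LinearMap.ext fun x => ?_⟩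
  have h1 : x = (x.1, 0) + x.2 • (0, 1) := by ext <;> simp
  conv_lhs => rw [h1, map_add, map_smul]
  simp [mul_comm]

variable (ρ : Representation F H M)

theorem dual_affineRep_extendForm (g : Affine ρ) (u : Module.Dual F M) (d : F) :
    (affineRep ρ).dual g (extendForm u d) =
      extendForm (ρ.dual g.lin u) (d - ρ.dual g.lin u g.vec) := by
  refine LinearMap.ext fun x => ?_
  rw [dual_apply_apply, affineRep_apply, extendForm_apply, extendForm_apply, Affine.vec_inv,
    Affine.lin_inv, dual_apply_apply, dual_apply_apply, map_add, map_smul, map_neg, smul_eq_mul]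
  ring

theorem extendForm_mem_invariants {u : Module.Dual F M} {d : F} :
    extendForm u d ∈ (affineRep ρ).dual.invariants ↔ u = 0 := by
  rw [mem_invariants]
  constructor
  · intro h
    ext m
    have h1 := h (Affine.ofVec ρ m)
    rw [dual_affineRep_extendForm, extendForm_inj, Affine.lin_ofVec, Affine.vec_ofVec, map_one,
      Module.End.one_apply] at h1
    simpa using h1.2
  · rintro rfl g
    rw [dual_affineRep_extendForm, map_zero, LinearMap.zero_apply, sub_zero]

theorem card_invariants_dual_affineRep :
    Nat.card (affineRep ρ).dual.invariants = Nat.card F := by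
  refine (Nat.card_congr (Equiv.ofBijective
    (fun d : F => (⟨extendForm 0 d, (extendForm_mem_invariants ρ).2 rfl⟩ :
      (affineRep ρ).dual.invariants)) ⟨fun d d' h => ?_, ?_⟩)).symm
  · exact (extendForm_inj.1 (congrArg Subtype.val h)).2
  · rintro ⟨w, hw⟩
    obtain ⟨u, d, rfl⟩ := exists_eq_extendForm w
    rw [extendForm_mem_invariants] at hw
    exact ⟨d, Subtype.ext (extendForm_inj.2 ⟨hw.symm, rfl⟩)⟩

variable {ρ}

/-- The action on the kernel of a fixed linear form. -/
def kerRep (u : ρ.dual.invariants) :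
    Representation F H (LinearMap.ker (u : Module.Dual F M)) :=
  (⟨LinearMap.ker (u : Module.Dual F M), fun h m hm => by
    rw [LinearMap.mem_ker] at hm ⊢
    rw [mem_invariants_dual.1 u.2, hm]⟩ : Subrepresentation ρ).toRepresentation

theorem coe_kerRep_apply (u : ρ.dual.invariants) (h : H)
    (m : LinearMap.ker (u : Module.Dual F M)) : (kerRep u h m : M) = ρ h m := rfl

theorem mem_dualStabilizer_extendForm (u : ρ.dual.invariants) {g : Affine ρ} :
    g ∈ dualStabilizer (affineRep ρ) (extendForm u 0) ↔ (u : Module.Dual F M) g.vec = 0 := by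
  rw [mem_dualStabilizer, dual_affineRep_extendForm, extendForm_inj, u.2 g.lin]
  simp

/-- The stabilizer in `M ⋊ H` of the form `(x, t) ↦ u x` on `M × F` is `ker u ⋊ H`, when `u` is
fixed by `H`. -/
def dualStabilizerEquiv (u : ρ.dual.invariants) :
    dualStabilizer (affineRep ρ) (extendForm u 0) ≃* Affine (kerRep u) where
  toFun g := ⟨⟨(g : Affine ρ).vec, (mem_dualStabilizer_extendForm u).1 g.2⟩, (g : Affine ρ).lin⟩
  invFun g := ⟨⟨g.vec, g.lin⟩, (mem_dualStabilizer_extendForm u).2 g.vec.2⟩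
  left_inv _ := rfl
  right_inv _ := rfl
  map_mul' _ _ := rfl

theorem card_invariants_dual_congr {H' M' : Type*} [Group H'] [AddCommGroup M'] [Module F M']
    {ρ' : Representation F H' M'} {π : H' →* H} (hπ : Function.Surjective π) (l : M ≃ₗ[F] M')
    (hl : ∀ h m, l (ρ (π h) m) = ρ' h (l m)) :
    Nat.card ρ.dual.invariants = Nat.card ρ'.dual.invariants := by
  refine (Nat.card_congr (Equiv.subtypeEquiv l.dualMap.toEquiv fun w => ?_)).symm
  change w ∈ ρ'.dual.invariants ↔ l.dualMap w ∈ ρ.dual.invariants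
  rw [mem_invariants_dual, mem_invariants_dual]
  constructor
  · intro h x m
    obtain ⟨y, rfl⟩ := hπ x
    simp only [LinearEquiv.dualMap_apply]
    rw [hl, h]
  · intro h y m
    have h1 := h (π y) (l.symm m)
    simp only [LinearEquiv.dualMap_apply] at h1
    rwa [hl, l.apply_symm_apply] at h1

/-- On the kernel of a nonzero fixed form, which is `M × {0}`, the group `M ⋊ H` acts
through `H`. -/
theorem card_invariants_dual_kerRep_affineRep (u : (affineRep ρ).dual.invariants)
    (hu : (u : Module.Dual F (M × F)) ≠ 0) :
    Nat.card (kerRep u).dual.invariants = Nat.card ρ.dual.invariants := by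
  obtain ⟨u, hinv⟩ := u
  obtain ⟨u', d, rfl⟩ := exists_eq_extendForm u
  obtain rfl := (extendForm_mem_invariants ρ).1 hinv
  have hd : d ≠ 0 := by
    rintro rfl
    exact hu (LinearMap.ext fun x => by simp)
  have hker : ∀ x : M × F, x ∈ LinearMap.ker (extendForm (0 : Module.Dual F M) d) ↔ x.2 = 0 := by
    intro x
    simp [hd]
  let l : M ≃ₗ[F] LinearMap.ker (extendForm (0 : Module.Dual F M) d) :=
    { toFun := fun m => ⟨(m, 0), (hker _).2 rfl⟩
      invFun := fun x => (x : M × F).1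
      map_add' := fun x y => by ext <;> simp
      map_smul' := fun c x => by ext <;> simp
      left_inv := fun x => rfl
      right_inv := fun x => Subtype.ext (Prod.ext rfl ((hker _).1 x.2).symm) }
  refine (card_invariants_dual_congr (π := Affine.linHom ρ) (fun h => ⟨Affine.ofLin ρ h, rfl⟩) l
    fun g m => Subtype.ext ?_).symm
  rw [coe_kerRep_apply, affineRep_apply]
  simp [l]

theorem dualOrbit_extendForm_subset (u : Module.Dual F M) (hu : u ≠ 0) (d : F) :
    Set.range (extendForm u) ⊆ dualOrbit (affineRep ρ) (extendForm u d) := by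
  rintro _ ⟨d', rfl⟩
  obtain ⟨m, hm⟩ := LinearMap.surjective hu (d - d')
  refine ⟨Affine.ofVec ρ m, ?_⟩
  simp only
  rw [dual_affineRep_extendForm, Affine.lin_ofVec, Affine.vec_ofVec, map_one,
    Module.End.one_apply, hm, sub_sub_cancel]

theorem ncard_range_extendForm (u : Module.Dual F M) :
    (Set.range (extendForm u)).ncard = Nat.card F := by
  rw [← Nat.card_coe_set_eq]
  exact Nat.card_congr (Equiv.ofInjective _ fun d d' h => (extendForm_inj.1 h).2).symm

variable [Finite F] [Finite H] [Finite M]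

/-- The recursion for the characters of degree `q = |F|` under iterated affine extension. A linear
form `(u, d)` on `M × F` is fixed by `M ⋊ H` when `u = 0`; its orbit has length `q`, and contains
`(u, 0)`, when `u ≠ 0` is fixed by `H`; in the remaining cases the orbit is longer. -/
theorem numIrrCharacters_affine_affineRep (ρ : Representation F H M) {c : ℕ}
    (hc : ∀ u : ρ.dual.invariants, (u : Module.Dual F M) ≠ 0 →
      Nat.card (kerRep u).dual.invariants = c) :
    numIrrCharacters (Nat.card F) (Affine (affineRep ρ)) =
      Nat.card F * numIrrCharacters (Nat.card F) (Affine ρ) +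
        (Nat.card ρ.dual.invariants - 1) * (c * Nat.card (H →* ℂˣ)) := by
  have := Fintype.ofFinite F
  let j : {u : ρ.dual.invariants // u ≠ 0} → Module.Dual F (M × F) :=
    fun u => extendForm (u.1 : Module.Dual F M) 0
  have hj : Function.Injective j := fun u u' h =>
    Subtype.ext (Subtype.ext (extendForm_inj.1 h).1)
  have hne : ∀ u : {u : ρ.dual.invariants // u ≠ 0}, (u.1 : Module.Dual F M) ≠ 0 :=
    fun u h => u.2 (Subtype.ext h)
  have hq : 2 ≤ Nat.card F := Finite.one_lt_card
  rw [numIrrCharacters_affine (affineRep ρ) hq (Set.range j),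
    card_invariants_dual_affineRep]
  · congr 1
    have := Fintype.ofFinite (Set.range j)
    have := Fintype.ofFinite {u : ρ.dual.invariants // u ≠ 0}
    have hfib : ∀ w : Set.range j,
        Nat.card (dualStabilizer (affineRep ρ) (w : Module.Dual F (M × F)) →* ℂˣ) =
          c * Nat.card (H →* ℂˣ) := by
      rintro ⟨_, u, rfl⟩
      rw [← hc u.1 (hne u), ← card_affine_monoidHom_units]
      exact Nat.card_congr ((dualStabilizerEquiv u.1).monoidHomCongrLeftEquiv)
    have : ∀ w : Set.range j,
        Finite (dualStabilizer (affineRep ρ) (w : Module.Dual F (M × F)) →* ℂˣ) :=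
      fun w => finite_monoidHom_units _
    rw [Nat.card_sigma, Finset.sum_congr rfl fun w _ => hfib w, Finset.sum_const, smul_eq_mul,
      Finset.card_univ, ← Nat.card_eq_fintype_card, Nat.card_congr (Equiv.ofInjective j hj).symm]
    congr 1
    have := Fintype.ofFinite ρ.dual.invariants
    classical
    rw [Nat.card_eq_fintype_card, Nat.card_eq_fintype_card, Fintype.card_subtype_compl,
      Fintype.card_subtype_eq]
  · rintro _ ⟨u, rfl⟩
    rw [← ncard_range_extendForm (u.1 : Module.Dual F M)]
    congr 1
    refine Set.Subset.antisymm ?_ (dualOrbit_extendForm_subset _ (hne u) 0)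
    rintro _ ⟨g, rfl⟩
    simp only [j]
    rw [dual_affineRep_extendForm, u.1.2 g.lin]
    exact Set.mem_range_self _
  · rintro _ ⟨u, rfl⟩ g ⟨u', hu'⟩
    simp only [j] at hu' ⊢
    rw [dual_affineRep_extendForm, u.1.2 g.lin, extendForm_inj] at hu' ⊢
    exact ⟨rfl, hu'.2.symm⟩
  · intro w
    obtain ⟨u, d, rfl⟩ := exists_eq_extendForm w
    by_cases hu : u = 0
    · exact Or.inl ((extendForm_mem_invariants ρ).2 hu)
    right
    by_cases hinv : u ∈ ρ.dual.invariants
    · right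
      obtain ⟨g, hg⟩ := dualOrbit_extendForm_subset (ρ := ρ) u hu d (Set.mem_range_self 0)
      exact ⟨g, ⟨⟨u, hinv⟩, fun h => hu (congrArg Subtype.val h)⟩, hg.symm⟩
    · left
      rw [mem_invariants] at hinv
      push Not at hinv
      obtain ⟨h, hh⟩ := hinv
      rw [← ncard_range_extendForm u]
      refine Set.ncard_lt_ncard ((Set.ssubset_iff_of_subset
        (dualOrbit_extendForm_subset u hu d)).2 ⟨_, ⟨Affine.ofLin ρ h, rfl⟩, ?_⟩) (Set.toFinite _)
      rintro ⟨d', hd'⟩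
      simp only at hd'
      rw [dual_affineRep_extendForm, extendForm_inj] at hd'
      exact hh hd'.1.symm

end AffineRep

end Representation

/-! ### Iterated affine extensions -/


/-- A finite group with a linear action on a finite vector space over `F`. -/
structure FiniteLinearGroup (F : Type u) [Field F] where
  /-- The group. -/
  G : Type u
  /-- The space it acts on. -/
  M : Type u
  [group : Group G]
  [finite_group : Finite G]
  [addCommGroup : AddCommGroup M]
  [module : Module F M]
  [finite_space : Finite M]
  /-- The action. -/
  ρ : Representation F G M

namespace FiniteLinearGroup

open Representation

attribute [instance] group finite_group addCommGroup module finite_space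

variable {F : Type u} [Field F] [Finite F]

/-- The affine group of `X`, acting on the homogenization of the space of `X`. -/
def affine (X : FiniteLinearGroup F) : FiniteLinearGroup F where
  G := Affine X.ρ
  M := X.M × F
  ρ := affineRep X.ρ

/-- The result of applying the affine extension `n` times. -/
def tower (X : FiniteLinearGroup F) : ℕ → FiniteLinearGroup F
  | 0 => X
  | n + 1 => (X.tower n).affine

/-- The number of linear forms fixed by the group. -/
noncomputable def numFixed (X : FiniteLinearGroup F) : ℕ := Nat.card X.ρ.dual.invariants

/-- The number of linear characters of the group. -/
noncomputable def numLinear (X : FiniteLinearGroup F) : ℕ := Nat.card (X.G →* ℂˣ)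

/-- The number of irreducible characters of the group of degree `|F|`. -/
noncomputable def numIrr (X : FiniteLinearGroup F) : ℕ := numIrrCharacters (Nat.card F) X.G

variable (X : FiniteLinearGroup F)

theorem numFixed_affine : X.affine.numFixed = Nat.card F := card_invariants_dual_affineRep X.ρ

theorem numLinear_affine : X.affine.numLinear = X.numFixed * X.numLinear :=
  card_affine_monoidHom_units X.ρ

/-- The hypotheses under which `numIrr_tower` computes the number of characters of degree
`q = |F|`. They hold for the two groups at which the pattern groups start, with `a = 1` and
`a = q ^ 2`. -/
structure IsBase (X : FiniteLinearGroup F) (a : ℕ) : Prop where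
  numFixed_eq : X.numFixed = Nat.card F ^ 2
  numLinear_eq : X.numLinear = a
  card_kerRep : ∀ u : X.ρ.dual.invariants, (u : Module.Dual F X.M) ≠ 0 →
    Nat.card (kerRep u).dual.invariants = Nat.card F
  numIrr_affine : X.affine.numIrr = 0

variable {X} {a : ℕ}

theorem numFixed_tower (n : ℕ) : (X.tower (n + 1)).numFixed = Nat.card F :=
  numFixed_affine _

theorem IsBase.numLinear_tower (h : X.IsBase a) (n : ℕ) :
    (X.tower (n + 1)).numLinear = Nat.card F ^ (n + 2) * a := by
  induction n with
  | zero =>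
    rw [tower, tower, numLinear_affine, h.numFixed_eq, h.numLinear_eq]
  | succ n ih =>
    rw [tower, numLinear_affine, ih, numFixed_tower]
    ring

theorem IsBase.numIrr_tower_two (h : X.IsBase a) :
    (X.tower 2).numIrr = (Nat.card F ^ 2 - 1) * (Nat.card F * a) := by
  have h1 := numIrrCharacters_affine_affineRep X.ρ h.card_kerRep
  have h2 : numIrrCharacters (Nat.card F) (Affine X.ρ) = 0 := h.numIrr_affine
  have h3 : Nat.card X.ρ.dual.invariants = _ := h.numFixed_eq
  have h4 : Nat.card (X.G →* ℂˣ) = _ := h.numLinear_eq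
  rw [h2, h3, h4, mul_zero, zero_add] at h1
  exact h1

/-- From the third step on, the stabilizers in the recursion come from the kernels of forms in
`card_invariants_dual_kerRep_affineRep`, so that the recursion involves no further data. -/
theorem numIrr_tower_add_three (n : ℕ) :
    (X.tower (n + 3)).numIrr = Nat.card F * (X.tower (n + 2)).numIrr +
      (Nat.card F - 1) * ((X.tower n).numFixed * (X.tower (n + 1)).numLinear) := by
  have h1 := numIrrCharacters_affine_affineRep (X.tower (n + 1)).ρ
    (c := (X.tower n).numFixed) fun u hu => card_invariants_dual_kerRep_affineRep u hu
  have h2 : Nat.card (X.tower (n + 1)).ρ.dual.invariants = _ := numFixed_affine (X.tower n)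
  rw [h2] at h1
  exact h1

theorem IsBase.numIrr_tower (h : X.IsBase a) (n : ℕ) :
    ((X.tower (n + 3)).numIrr : ℤ) = (Nat.card F : ℤ) ^ (n + 2) * (Nat.card F - 1) *
      ((Nat.card F : ℤ) ^ 2 + (n + 1) * Nat.card F + 1) * a := by
  have hq : 1 ≤ Nat.card F := Finite.card_pos
  have hq2 : 1 ≤ Nat.card F ^ 2 := Nat.one_le_pow _ _ hq
  induction n with
  | zero =>
    rw [numIrr_tower_add_three, h.numIrr_tower_two, h.numLinear_tower, tower, h.numFixed_eq]
    push_cast [hq, hq2]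
    ring
  | succ n ih =>
    rw [numIrr_tower_add_three, h.numLinear_tower, numFixed_tower]
    push_cast [hq]
    rw [ih]
    ring

end FiniteLinearGroup

/-! ### Unitriangular matrices as affine transformations -/

section Matrices

open Representation

variable {F : Type*} [Field F]

/-- The natural action of a group of invertible matrices on column vectors. -/
def naturalRep {n : ℕ} (S : Subgroup (GL (Fin n) F)) : Representation F S (Fin n → F) where
  toFun g := ((g : GL (Fin n) F) : Matrix (Fin n) (Fin n) F).mulVecLin
  map_one' := Matrix.mulVecLin_one
  map_mul' _ _ := Matrix.mulVecLin_mul _ _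

theorem naturalRep_apply {n : ℕ} (S : Subgroup (GL (Fin n) F)) (g : S) (x : Fin n → F) :
    naturalRep S g x = ((g : GL (Fin n) F) : Matrix (Fin n) (Fin n) F).mulVec x := rfl

/-- The matrix with block rows `(B, v)` and `(0, 1)`. -/
def affineMatrix {n : ℕ} (B : Matrix (Fin n) (Fin n) F) (v : Fin n → F) :
    Matrix (Fin (n + 1)) (Fin (n + 1)) F :=
  Matrix.of (Fin.snoc (fun i => Fin.snoc (B i) (v i)) (Fin.snoc (fun _ => 0) 1) : _ → _ → F)

section

variable {n : ℕ} (B : Matrix (Fin n) (Fin n) F) (v : Fin n → F)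

@[simp] theorem affineMatrix_castSucc_castSucc (i j : Fin n) :
    affineMatrix B v i.castSucc j.castSucc = B i j := by simp [affineMatrix]

@[simp] theorem affineMatrix_castSucc_last (i : Fin n) :
    affineMatrix B v i.castSucc (Fin.last n) = v i := by simp [affineMatrix]

@[simp] theorem affineMatrix_last_castSucc (j : Fin n) :
    affineMatrix B v (Fin.last n) j.castSucc = 0 := by simp [affineMatrix]

@[simp] theorem affineMatrix_last_last : affineMatrix B v (Fin.last n) (Fin.last n) = 1 := by
  simp [affineMatrix]

theorem affineMatrix_mul (B' : Matrix (Fin n) (Fin n) F) (v' : Fin n → F) :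
    affineMatrix B v * affineMatrix B' v' = affineMatrix (B * B') (v + B.mulVec v') := by
  ext i j
  rw [Matrix.mul_apply, Fin.sum_univ_castSucc]
  refine Fin.lastCases ?_ (fun i => ?_) i <;> refine Fin.lastCases ?_ (fun j => ?_) j <;>
    simp [Matrix.mul_apply, Matrix.mulVec, dotProduct, add_comm]

theorem affineMatrix_one : affineMatrix (1 : Matrix (Fin n) (Fin n) F) 0 = 1 := by
  ext i j
  refine Fin.lastCases ?_ (fun i => ?_) i <;> refine Fin.lastCases ?_ (fun j => ?_) j <;>
    simp [Matrix.one_apply, Fin.castSucc_ne_last, (Fin.castSucc_ne_last _).symm]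

theorem affineMatrix_mulVec_snoc (x : Fin n → F) (t : F) :
    (affineMatrix B v).mulVec (Fin.snoc x t : Fin (n + 1) → F) =
      (Fin.snoc (B.mulVec x + t • v) t : Fin (n + 1) → F) := by
  ext i
  rw [Matrix.mulVec, dotProduct, Fin.sum_univ_castSucc]
  refine Fin.lastCases ?_ (fun i => ?_) i <;> simp [Matrix.mulVec, dotProduct, mul_comm t]

end

/-- `S'` is the group of all invertible matrices with block rows `(B, v)` and `(0, 1)`, where `B`
runs through `S`. -/
def IsAffineExtension {n : ℕ} (S : Subgroup (GL (Fin n) F)) (S' : Subgroup (GL (Fin (n + 1)) F)) :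
    Prop :=
  ∀ A : GL (Fin (n + 1)) F, A ∈ S' ↔ ∃ B ∈ S, ∃ v,
    (A : Matrix (Fin (n + 1)) (Fin (n + 1)) F) = affineMatrix (B : Matrix (Fin n) (Fin n) F) v

/-- The affine group of `S` realized by matrices of size one larger. -/
def affineToGL {n : ℕ} (S : Subgroup (GL (Fin n) F)) :
    Affine (naturalRep S) →* GL (Fin (n + 1)) F :=
  MonoidHom.toHomUnits
    { toFun := fun g => affineMatrix ((g.lin : GL (Fin n) F) : Matrix (Fin n) (Fin n) F) g.vec
      map_one' := affineMatrix_one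
      map_mul' := fun g g' => by
        rw [affineMatrix_mul]
        rfl }

theorem coe_affineToGL {n : ℕ} (S : Subgroup (GL (Fin n) F)) (g : Affine (naturalRep S)) :
    (affineToGL S g : Matrix (Fin (n + 1)) (Fin (n + 1)) F) =
      affineMatrix ((g.lin : GL (Fin n) F) : Matrix (Fin n) (Fin n) F) g.vec := rfl

theorem affineToGL_injective {n : ℕ} (S : Subgroup (GL (Fin n) F)) :
    Function.Injective (affineToGL S) := by
  intro g g' h
  have h1 := congrArg (fun A : GL (Fin (n + 1)) F => (A : Matrix (Fin (n + 1)) (Fin (n + 1)) F)) h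
  simp only [coe_affineToGL] at h1
  refine Affine.ext (funext fun i => ?_) (Subtype.ext (Units.ext (Matrix.ext fun i j => ?_)))
  · simpa using congrFun (congrFun h1 i.castSucc) (Fin.last n)
  · simpa using congrFun (congrFun h1 i.castSucc) j.castSucc

namespace IsAffineExtension

variable {n : ℕ} {S : Subgroup (GL (Fin n) F)} {S' : Subgroup (GL (Fin (n + 1)) F)}

theorem range_eq (h : IsAffineExtension S S') : (affineToGL S).range = S' := by
  ext A
  rw [h A, MonoidHom.mem_range]
  constructor
  · rintro ⟨g, rfl⟩
    exact ⟨g.lin, g.lin.2, g.vec, rfl⟩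
  · rintro ⟨B, hB, v, hA⟩
    exact ⟨⟨v, ⟨B, hB⟩⟩, Units.ext hA.symm⟩

/-- An affine extension of a matrix group is its affine group. -/
noncomputable def equiv (h : IsAffineExtension S S') : Affine (naturalRep S) ≃* S' :=
  (MonoidHom.ofInjective (affineToGL_injective S)).trans (MulEquiv.subgroupCongr h.range_eq)

theorem coe_equiv (h : IsAffineExtension S S') (g : Affine (naturalRep S)) :
    (h.equiv g : GL (Fin (n + 1)) F) = affineToGL S g := rfl

end IsAffineExtension

/-- Splitting off the last coordinate of a vector. -/
def snocLinearEquiv (F : Type*) [Field F] (n : ℕ) : ((Fin n → F) × F) ≃ₗ[F] (Fin (n + 1) → F) where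
  toFun x := Fin.snoc x.1 x.2
  invFun y := (Fin.init y, y (Fin.last n))
  map_add' x y := by
    ext i
    refine Fin.lastCases ?_ (fun i => ?_) i <;> simp
  map_smul' c x := by
    ext i
    refine Fin.lastCases ?_ (fun i => ?_) i <;> simp
  left_inv x := by simp
  right_inv y := by simp

theorem IsAffineExtension.snocLinearEquiv_affineRep {n : ℕ} {S : Subgroup (GL (Fin n) F)}
    {S' : Subgroup (GL (Fin (n + 1)) F)} (h : IsAffineExtension S S')
    (g : Affine (naturalRep S)) (x : (Fin n → F) × F) :
    snocLinearEquiv F n (affineRep (naturalRep S) g x) =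
      naturalRep S' (h.equiv g) (snocLinearEquiv F n x) := by
  rw [naturalRep_apply, h.coe_equiv, coe_affineToGL]
  exact (affineMatrix_mulVec_snoc _ _ _ _).symm

end Matrices

section MatrixTower

open Representation FiniteLinearGroup

variable {F : Type u} [Field F] [Finite F]

/-- A group of matrices over a finite field, with its natural action. -/
def naturalLinearGroup {n : ℕ} (S : Subgroup (GL (Fin n) F)) : FiniteLinearGroup F where
  G := S
  M := Fin n → F
  ρ := naturalRep S

/-- Iterated affine extensions of matrix groups are the abstract ones. -/
theorem exists_tower_equiv {k : ℕ} {S : ∀ n, Subgroup (GL (Fin (k + n)) F)}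
    (hS : ∀ n, IsAffineExtension (S n) (S (n + 1))) (n : ℕ) :
    ∃ (e : ((naturalLinearGroup (S 0)).tower n).G ≃* S n)
      (l : ((naturalLinearGroup (S 0)).tower n).M ≃ₗ[F] (Fin (k + n) → F)),
      ∀ g x, l (((naturalLinearGroup (S 0)).tower n).ρ g x) = naturalRep (S n) (e g) (l x) := by
  induction n with
  | zero => exact ⟨MulEquiv.refl _, LinearEquiv.refl _ _, fun _ _ => rfl⟩
  | succ n ih =>
    obtain ⟨e, l, hl⟩ := ih
    refine ⟨(Affine.congr e l hl).trans (hS n).equiv,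
      (l.prodCongr (LinearEquiv.refl F F)).trans (snocLinearEquiv F (k + n)), fun g x => ?_⟩
    refine Eq.trans ?_ ((hS n).snocLinearEquiv_affineRep _ _)
    refine congrArg (snocLinearEquiv F (k + n)) (Prod.ext ?_ rfl)
    change l (((naturalLinearGroup (S 0)).tower n).ρ g.lin x.1 + x.2 • g.vec) = _
    rw [map_add, map_smul, hl]
    rfl

theorem numIrrCharacters_eq_numIrr_tower {k : ℕ} {S : ∀ n, Subgroup (GL (Fin (k + n)) F)}
    (hS : ∀ n, IsAffineExtension (S n) (S (n + 1))) (n : ℕ) :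
    numIrrCharacters (Nat.card F) (S n) = ((naturalLinearGroup (S 0)).tower n).numIrr := by
  obtain ⟨e, -⟩ := exists_tower_equiv hS n
  exact (numIrrCharacters_congr e _).symm

end MatrixTower

/-! ### The pattern groups as iterated affine extensions -/

section Pattern

variable {F : Type*} [Field F]

theorem affineMatrix_mem_unitriangularGroup {n : ℕ} {B : GL (Fin n) F} {v : Fin n → F}
    {A : GL (Fin (n + 1)) F}
    (hA : (A : Matrix (Fin (n + 1)) (Fin (n + 1)) F) =
      affineMatrix (B : Matrix (Fin n) (Fin n) F) v) :
    A ∈ unitriangularGroup F (n + 1) ↔ B ∈ unitriangularGroup F n := by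
  change ((∀ k l : Fin (n + 1), l < k → (A : Matrix _ _ F) k l = 0) ∧
      ∀ k : Fin (n + 1), (A : Matrix _ _ F) k k = 1) ↔
    ((∀ k l : Fin n, l < k → (B : Matrix _ _ F) k l = 0) ∧ ∀ k : Fin n, (B : Matrix _ _ F) k k = 1)
  rw [hA]
  constructor
  · rintro ⟨h1, h2⟩
    exact ⟨fun k l h => by simpa using h1 k.castSucc l.castSucc (by simpa using h),
      fun k => by simpa using h2 k.castSucc⟩
  · rintro ⟨h1, h2⟩
    refine ⟨fun k l => ?_, fun k => ?_⟩
    · refine Fin.lastCases ?_ (fun l => ?_) l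
      · exact fun h => absurd h (Fin.le_last _).not_gt
      · refine Fin.lastCases ?_ (fun k => ?_) k
        · simp
        · simpa using h1 k l
    · refine Fin.lastCases ?_ (fun k => ?_) k
      · simp
      · simpa using h2 k

/-- Every unitriangular matrix has a unitriangular upper left block. -/
theorem exists_eq_affineMatrix {n : ℕ} {A : GL (Fin (n + 1)) F}
    (hA : A ∈ unitriangularGroup F (n + 1)) :
    ∃ (B : GL (Fin n) F) (v : Fin n → F), (A : Matrix (Fin (n + 1)) (Fin (n + 1)) F) =
      affineMatrix (B : Matrix (Fin n) (Fin n) F) v := by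
  obtain ⟨h1, h2⟩ := hA
  let B₀ : Matrix (Fin n) (Fin n) F :=
    (A : Matrix (Fin (n + 1)) (Fin (n + 1)) F).submatrix Fin.castSucc Fin.castSucc
  have hdet : B₀.det = 1 := by
    rw [Matrix.det_of_isUpperTriangular fun k l h => h1 k.castSucc l.castSucc h]
    exact Finset.prod_eq_one fun k _ => h2 k.castSucc
  refine ⟨Matrix.GeneralLinearGroup.mkOfDetNeZero B₀ (hdet ▸ one_ne_zero),
    fun i => A i.castSucc (Fin.last n), ?_⟩
  ext i j
  refine Fin.lastCases ?_ (fun i => ?_) i <;> refine Fin.lastCases ?_ (fun j => ?_) j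
  · simpa using h2 (Fin.last n)
  · simpa using h1 (Fin.last n) j.castSucc (Fin.castSucc_lt_last j)
  · simp
  · simp [Matrix.GeneralLinearGroup.mkOfDetNeZero, B₀]

/-- A subgroup of the unitriangular group whose membership only depends on the upper left block is
an affine extension. -/
theorem isAffineExtension_of_forall {n : ℕ} {S : Subgroup (GL (Fin n) F)}
    {S' : Subgroup (GL (Fin (n + 1)) F)} (h' : S' ≤ unitriangularGroup F (n + 1))
    (h : ∀ (A : GL (Fin (n + 1)) F) (B : GL (Fin n) F) (v : Fin n → F),
      (A : Matrix (Fin (n + 1)) (Fin (n + 1)) F) = affineMatrix (B : Matrix (Fin n) (Fin n) F) v →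
      (A ∈ S' ↔ B ∈ S)) : IsAffineExtension S S' := by
  intro A
  constructor
  · intro hA
    obtain ⟨B, v, hBv⟩ := exists_eq_affineMatrix (h' hA)
    exact ⟨B, (h A B v hBv).1 hA, v, hBv⟩
  · rintro ⟨B, hB, v, hBv⟩
    exact (h A B v hBv).2 hB

theorem mem_pGroup {n i : ℕ} {A : GL (Fin n) F} :
    A ∈ pGroup F n i ↔ A ∈ unitriangularGroup F n ∧
      ∀ k l : Fin n, (l : ℕ) + 1 = i → k ≠ l → (A : Matrix (Fin n) (Fin n) F) k l = 0 := Iff.rfl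

theorem mem_qGroup {n i j : ℕ} {A : GL (Fin n) F} :
    A ∈ qGroup F n i j ↔ A ∈ unitriangularGroup F n ∧
      (∀ y l : Fin n, (l : ℕ) + 1 = i → y < l → (A : Matrix (Fin n) (Fin n) F) y l = 0) ∧
      ∀ x l : Fin n, (l : ℕ) + 1 = j → x < l → (x : ℕ) + 1 ≠ i →
        (A : Matrix (Fin n) (Fin n) F) x l = 0 := Iff.rfl

theorem isAffineExtension_pGroup {n i : ℕ} (hi : i ≤ n) :
    IsAffineExtension (pGroup F n i) (pGroup F (n + 1) i) := by
  refine isAffineExtension_of_forall (fun A hA => hA.1) fun A B v h => ?_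
  rw [mem_pGroup, mem_pGroup, affineMatrix_mem_unitriangularGroup h, h]
  refine and_congr_right fun _ => ⟨fun h1 k l hl hkl => ?_, fun h1 k l => ?_⟩
  · simpa using h1 k.castSucc l.castSucc hl (by simpa using hkl)
  · refine Fin.lastCases (fun hl => ?_) (fun l => ?_) l
    · rw [Fin.val_last] at hl
      omega
    · refine Fin.lastCases ?_ (fun k => ?_) k
      · simp
      · simpa using h1 k l

theorem isAffineExtension_qGroup {n i j : ℕ} (hi : i ≤ n) (hj : j ≤ n) :
    IsAffineExtension (qGroup F n i j) (qGroup F (n + 1) i j) := by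
  refine isAffineExtension_of_forall (fun A hA => hA.1) fun A B v h => ?_
  rw [mem_qGroup, mem_qGroup, affineMatrix_mem_unitriangularGroup h, h]
  refine and_congr_right fun _ => and_congr ⟨fun h1 k l hl hkl => ?_, fun h1 k l => ?_⟩
    ⟨fun h1 k l hl hkl hki => ?_, fun h1 k l => ?_⟩
  · simpa using h1 k.castSucc l.castSucc hl (by simpa using hkl)
  · refine Fin.lastCases (fun hl => ?_) (fun l => ?_) l
    · rw [Fin.val_last] at hl
      omega
    · refine Fin.lastCases ?_ (fun k => ?_) k
      · simp
      · simpa using h1 k l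
  · simpa using h1 k.castSucc l.castSucc hl (by simpa using hkl) hki
  · refine Fin.lastCases (fun hl => ?_) (fun l => ?_) l
    · rw [Fin.val_last] at hl
      omega
    · refine Fin.lastCases ?_ (fun k => ?_) k
      · simp
      · simpa using h1 k l

end Pattern

/-! ### The initial groups -/

section Initial

open Representation

theorem card_monoidHom_units_of_commute {G : Type*} [Group G] [Finite G]
    (hG : ∀ a b : G, a * b = b * a) : Nat.card (G →* ℂˣ) = Nat.card G := by
  let _ : CommGroup G := { ‹Group G› with mul_comm := hG }
  exact CommGroup.card_monoidHom_of_hasEnoughRootsOfUnity G ℂ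

section

variable {F : Type*} [Field F]

theorem card_ker_mul_card {V : Type*} [AddCommGroup V] [Module F V] [Finite V]
    {u : Module.Dual F V} (hu : u ≠ 0) :
    Nat.card (LinearMap.ker u) * Nat.card F = Nat.card V := by
  rw [Submodule.card_eq_card_quotient_mul_card (LinearMap.ker u),
    Nat.card_congr (u.quotKerEquivOfSurjective (LinearMap.surjective hu)).toEquiv]

variable [Finite F]

theorem card_invariants_dual_of_trivial {H M : Type*} [Group H] [AddCommGroup M] [Module F M]
    [Finite M] {ρ : Representation F H M} (h : ∀ x m, ρ x m = m) :
    Nat.card ρ.dual.invariants = Nat.card M := by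
  rw [← card_dual (F := F) (M := M)]
  exact Nat.card_congr (Equiv.subtypeUnivEquiv fun w =>
    mem_invariants_dual.2 fun x m => by rw [h])

theorem card_invariants_dual_of_mem_iff {H M : Type*} [Group H] [AddCommGroup M] [Module F M]
    [Finite M] {ρ : Representation F H M} {e : M} (he : e ≠ 0)
    (h : ∀ w : Module.Dual F M, w ∈ ρ.dual.invariants ↔ w e = 0) :
    Nat.card ρ.dual.invariants * Nat.card F = Nat.card M := by
  have h1 : ρ.dual.invariants = LinearMap.ker (Module.Dual.eval F M e) := by
    ext w
    rw [h, LinearMap.mem_ker, Module.Dual.eval_apply]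
  rw [h1, card_ker_mul_card, card_dual]
  intro h2
  obtain ⟨w, hw⟩ := Module.Projective.exists_dual_eq_one F he
  exact one_ne_zero (hw.symm.trans (LinearMap.congr_fun h2 w))

end

variable {F : Type u} [Field F]

theorem eq_one_of_mem_pGroup {A : GL (Fin 2) F} (hA : A ∈ pGroup F 2 2) : A = 1 := by
  obtain ⟨⟨h1, h2⟩, h3⟩ := hA
  ext i j
  fin_cases i <;> fin_cases j
  · simpa using h2 0
  · simpa using h3 0 1 rfl (by simp)
  · simpa using h1 1 0 (by simp)
  · simpa using h2 1

theorem mulVec_of_mem_qGroup {A : GL (Fin 3) F} (hA : A ∈ qGroup F 3 1 3) (x : Fin 3 → F) :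
    (A : Matrix (Fin 3) (Fin 3) F).mulVec x =
      x + ((A : Matrix (Fin 3) (Fin 3) F) 0 1 * x 1 + (A : Matrix (Fin 3) (Fin 3) F) 0 2 * x 2) •
        Pi.single 0 1 := by
  obtain ⟨⟨h1, h2⟩, -, h3⟩ := hA
  have e00 : (A : Matrix (Fin 3) (Fin 3) F) 0 0 = 1 := h2 0
  have e11 : (A : Matrix (Fin 3) (Fin 3) F) 1 1 = 1 := h2 1
  have e22 : (A : Matrix (Fin 3) (Fin 3) F) 2 2 = 1 := h2 2
  have e10 : (A : Matrix (Fin 3) (Fin 3) F) 1 0 = 0 := h1 1 0 (by decide)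
  have e20 : (A : Matrix (Fin 3) (Fin 3) F) 2 0 = 0 := h1 2 0 (by decide)
  have e21 : (A : Matrix (Fin 3) (Fin 3) F) 2 1 = 0 := h1 2 1 (by decide)
  have e12 : (A : Matrix (Fin 3) (Fin 3) F) 1 2 = 0 := h3 1 2 rfl (by decide) (by decide)
  ext i
  fin_cases i <;>
    simp [Matrix.mulVec, dotProduct, Fin.sum_univ_three, e00, e11, e22, e10, e20, e21, e12]
  ring

theorem exists_mem_qGroup (a b : F) : ∃ A ∈ qGroup F 3 1 3,
    (A : Matrix (Fin 3) (Fin 3) F) 0 1 = a ∧ (A : Matrix (Fin 3) (Fin 3) F) 0 2 = b := by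
  let A₀ : Matrix (Fin 3) (Fin 3) F := !![1, a, b; 0, 1, 0; 0, 0, 1]
  have hdet : A₀.det ≠ 0 := by simp [A₀, Matrix.det_fin_three]
  have hA : ∀ i j, (Matrix.GeneralLinearGroup.mkOfDetNeZero A₀ hdet : Matrix _ _ F) i j = A₀ i j :=
    fun _ _ => rfl
  refine ⟨Matrix.GeneralLinearGroup.mkOfDetNeZero A₀ hdet, ?_, rfl, rfl⟩
  rw [mem_qGroup]
  refine ⟨⟨fun k l h => ?_, fun k => ?_⟩, fun y l hl hy => ?_, fun x l hl hx hx1 => ?_⟩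
  · refine (hA k l).trans ?_
    fin_cases k <;> fin_cases l <;> simp_all [A₀]
  · refine (hA k k).trans ?_
    fin_cases k <;> simp [A₀]
  · fin_cases l <;> simp_all
  · rw [hA]
    fin_cases x <;> fin_cases l <;> simp_all [A₀]


variable [Finite F]

theorem isBase_naturalLinearGroup {n a : ℕ} {S : Subgroup (GL (Fin n) F)}
    (h1 : Nat.card (naturalRep S).dual.invariants = Nat.card F ^ 2)
    (h2 : Nat.card (S →* ℂˣ) = a)
    (h3 : ∀ u : (naturalRep S).dual.invariants, (u : Module.Dual F (Fin n → F)) ≠ 0 →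
      Nat.card (kerRep u).dual.invariants = Nat.card F)
    (h4 : numIrrCharacters (Nat.card F) (Affine (naturalRep S)) = 0) :
    (naturalLinearGroup S).IsBase a :=
  ⟨h1, h2, h3, h4⟩

/-- Here the group is trivial, and its affine extension is commutative. -/
theorem isBase_pGroup : (naturalLinearGroup (pGroup F 2 2)).IsBase 1 := by
  have hone : ∀ g : pGroup F 2 2, g = 1 := fun g => Subtype.ext (eq_one_of_mem_pGroup g.2)
  have hcomm : ∀ a b : pGroup F 2 2, a * b = b * a := fun a b => by rw [hone a, hone b]
  have htriv : ∀ (g : pGroup F 2 2) (x : Fin 2 → F), naturalRep (pGroup F 2 2) g x = x :=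
    fun g x => by rw [hone g, map_one, Module.End.one_apply]
  have hcard : Nat.card (Fin 2 → F) = Nat.card F ^ 2 := by simp [Nat.card_fun]
  have hq : 2 ≤ Nat.card F := Finite.one_lt_card
  refine isBase_naturalLinearGroup ?_ ?_ (fun u hu => ?_) ?_
  · exact (card_invariants_dual_of_trivial htriv).trans hcard
  · rw [card_monoidHom_units_of_commute hcomm]
    have : Subsingleton (pGroup F 2 2) := ⟨fun a b => by rw [hone a, hone b]⟩
    exact Nat.card_unique
  · rw [card_invariants_dual_of_trivial fun g x => Subtype.ext (htriv g x)]
    have h1 := card_ker_mul_card hu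
    rw [hcard, sq] at h1
    exact Nat.eq_of_mul_eq_mul_right (by omega) h1
  · refine numIrrCharacters_eq_zero_of_commute (fun a b => Affine.ext ?_ (hcomm _ _)) hq
    rw [Affine.vec_mul, Affine.vec_mul, htriv, htriv, add_comm]

/-- Here the group consists of the maps `x ↦ x + (α x₁ + β x₂) e` with `e` the first unit vector. It
acts freely on the linear forms that do not vanish at `e`, so their orbits have length `q ^ 2`, and
it fixes the other forms. -/
theorem isBase_qGroup : (naturalLinearGroup (qGroup F 3 1 3)).IsBase (Nat.card F ^ 2) := by
  have hq : 2 ≤ Nat.card F := Finite.one_lt_card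
  have hcard : Nat.card (Fin 3 → F) = Nat.card F ^ 3 := by simp [Nat.card_fun]
  set σ := naturalRep (qGroup F 3 1 3)
  let e : Fin 3 → F := Pi.single 0 1
  have he : e ≠ 0 := by simp [e]
  have he1 : e 1 = 0 := by simp [e]
  have he2 : e 2 = 0 := by simp [e]
  let α : qGroup F 3 1 3 → F := fun g => (g : GL (Fin 3) F) 0 1
  let β : qGroup F 3 1 3 → F := fun g => (g : GL (Fin 3) F) 0 2
  have hact : ∀ g x, σ g x = x + (α g * x 1 + β g * x 2) • e :=
    fun g x => mulVec_of_mem_qGroup g.2 x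
  have hex : ∀ a b, ∃ g, α g = a ∧ β g = b := fun a b => by
    obtain ⟨A, hA, h1, h2⟩ := exists_mem_qGroup a b
    exact ⟨⟨A, hA⟩, h1, h2⟩
  have hfaith : ∀ g h, (∀ x, σ g x = σ h x) → g = h := fun g h hgh =>
    Subtype.ext (Units.ext (Matrix.mulVec_injective (funext hgh)))
  have hinj : ∀ g h, α g = α h → β g = β h → g = h := fun g h h1 h2 =>
    hfaith g h fun x => by rw [hact, hact, h1, h2]
  have hcomm : ∀ g h : qGroup F 3 1 3, g * h = h * g := fun g h => hfaith _ _ fun x => by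
    rw [map_mul, map_mul, Module.End.mul_apply, Module.End.mul_apply, hact h, hact g, hact g,
      hact h]
    simp only [Pi.add_apply, Pi.smul_apply, he1, he2, smul_zero, add_zero]
    abel
  have hG : Nat.card (qGroup F 3 1 3) = Nat.card F ^ 2 := by
    rw [sq, ← Nat.card_prod]
    refine Nat.card_congr (Equiv.ofBijective (fun g => (α g, β g)) ⟨fun g h hgh => ?_, ?_⟩)
    · rw [Prod.mk.injEq] at hgh
      exact hinj g h hgh.1 hgh.2
    · rintro ⟨a, b⟩
      obtain ⟨g, h1, h2⟩ := hex a b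
      exact ⟨g, Prod.ext h1 h2⟩
  -- If `x` is not a multiple of `e`, then some element of the group moves `x` to `x + e`.
  have hmove : ∀ x : Fin 3 → F, x 1 ≠ 0 ∨ x 2 ≠ 0 → ∃ g, σ g x = x + e := by
    rintro x (hx | hx)
    · obtain ⟨g, h1, h2⟩ := hex (x 1)⁻¹ 0
      exact ⟨g, by rw [hact, h1, h2, inv_mul_cancel₀ hx, zero_mul, add_zero, one_smul]⟩
    · obtain ⟨g, h1, h2⟩ := hex 0 (x 2)⁻¹
      exact ⟨g, by rw [hact, h1, h2, inv_mul_cancel₀ hx, zero_mul, zero_add, one_smul]⟩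
  have hinv : ∀ w : Module.Dual F (Fin 3 → F), w ∈ σ.dual.invariants ↔ w e = 0 := by
    intro w
    rw [mem_invariants_dual]
    constructor
    · intro h
      obtain ⟨g, hg⟩ := hmove (Pi.single 1 1) (by simp)
      have h1 := h g (Pi.single 1 1)
      rwa [hg, map_add, add_eq_left] at h1
    · intro h g x
      rw [hact, map_add, map_smul, h, smul_zero, add_zero]
  refine isBase_naturalLinearGroup ?_ ?_ (fun u hu => ?_) ?_
  · have h1 := card_invariants_dual_of_mem_iff he hinv
    rw [hcard, pow_succ] at h1
    exact Nat.eq_of_mul_eq_mul_right (by omega) h1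
  · rw [card_monoidHom_units_of_commute hcomm, hG]
  · have hue : (u : Module.Dual F (Fin 3 → F)) e = 0 := (hinv _).1 u.2
    let e' : LinearMap.ker (u : Module.Dual F (Fin 3 → F)) := ⟨e, hue⟩
    -- The kernel of `u` contains a vector which is not a multiple of `e`.
    obtain ⟨y, hy⟩ : ∃ y : LinearMap.ker (u : Module.Dual F (Fin 3 → F)),
        (y : Fin 3 → F) 1 ≠ 0 ∨ (y : Fin 3 → F) 2 ≠ 0 := by
      refine ⟨⟨(u : Module.Dual F (Fin 3 → F)) (Pi.single 1 1) • Pi.single 2 1 -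
        (u : Module.Dual F (Fin 3 → F)) (Pi.single 2 1) • Pi.single 1 1, ?_⟩, ?_⟩
      · rw [LinearMap.mem_ker, map_sub, map_smul, map_smul, smul_eq_mul, smul_eq_mul, mul_comm,
          sub_self]
      · by_contra! h
        refine hu ((Pi.basisFun F (Fin 3)).ext fun i => ?_)
        rw [Pi.basisFun_apply, LinearMap.zero_apply]
        fin_cases i
        · exact hue
        · simpa using h.2
        · simpa using h.1
    have hinv' : ∀ w : Module.Dual F (LinearMap.ker (u : Module.Dual F (Fin 3 → F))),
        w ∈ (kerRep u).dual.invariants ↔ w e' = 0 := by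
      intro w
      rw [mem_invariants_dual]
      constructor
      · intro h
        obtain ⟨g, hg⟩ := hmove y hy
        have h1 := h g y
        have h2 : kerRep u g y = y + e' := Subtype.ext hg
        rwa [h2, map_add, add_eq_left] at h1
      · intro h g x
        have h2 : kerRep u g x =
            x + (α g * (x : Fin 3 → F) 1 + β g * (x : Fin 3 → F) 2) • e' :=
          Subtype.ext (hact g x)
        rw [h2, map_add, map_smul, h, smul_zero, add_zero]
    have h1 := card_invariants_dual_of_mem_iff (e := e')
      (fun h => he (congrArg Subtype.val h)) hinv'
    have h2 := card_ker_mul_card hu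
    rw [hcard, ← h1, pow_succ, sq] at h2
    exact Nat.eq_of_mul_eq_mul_right (by omega) (Nat.eq_of_mul_eq_mul_right (by omega) h2)
  · rw [numIrrCharacters_affine σ hq ∅ (by simp) (by simp),
      numIrrCharacters_eq_zero_of_commute hcomm hq, mul_zero, zero_add]
    · simp
    · intro w
      by_cases hw : w ∈ σ.dual.invariants
      · exact Or.inl hw
      refine Or.inr (Or.inl ?_)
      rw [hinv] at hw
      have hstab : dualStabilizer σ w = ⊥ := by
        rw [Subgroup.eq_bot_iff_forall]
        intro g hg
        have h1 : ∀ x : Fin 3 → F, α g * x 1 + β g * x 2 = 0 := by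
          intro x
          have h2 := apply_of_mem_dualStabilizer hg x
          rw [hact, map_add, add_eq_left, map_smul] at h2
          exact (smul_eq_zero.1 h2).resolve_right hw
        refine hfaith _ _ fun x => ?_
        rw [hact, h1, zero_smul, add_zero, map_one, Module.End.one_apply]
      rw [← index_dualStabilizer, hstab, Subgroup.index_bot, hG, sq]
      exact lt_mul_of_one_lt_left (by omega) (by omega)

end Initial

/-! ### The numbers of characters of degree `q` -/

section Numbers

open FiniteLinearGroup

variable (F : Type u) [Field F] [Finite F]

theorem numIrrCharacters_pGroup (n : ℕ) :
    numIrrCharacters (Nat.card F) (pGroup F (2 + n) 2) =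
      ((naturalLinearGroup (pGroup F 2 2)).tower n).numIrr :=
  numIrrCharacters_eq_numIrr_tower (S := fun n => pGroup F (2 + n) 2)
    (fun n => isAffineExtension_pGroup (by omega)) n

theorem numIrrCharacters_qGroup (n : ℕ) :
    numIrrCharacters (Nat.card F) (qGroup F (3 + n) 1 3) =
      ((naturalLinearGroup (qGroup F 3 1 3)).tower n).numIrr :=
  numIrrCharacters_eq_numIrr_tower (S := fun n => qGroup F (3 + n) 1 3)
    (fun n => isAffineExtension_qGroup (by omega) (by omega)) n

theorem FiniteLinearGroup.IsBase.numIrr_tower_eq_mul {X Y : FiniteLinearGroup F} {a : ℕ}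
    (hX : X.IsBase 1) (hY : Y.IsBase a) (n : ℕ) :
    (Y.tower (n + 1)).numIrr = a * (X.tower (n + 1)).numIrr := by
  match n with
  | 0 =>
    have h1 : (X.tower 1).numIrr = 0 := hX.numIrr_affine
    have h2 : (Y.tower 1).numIrr = 0 := hY.numIrr_affine
    rw [h1, h2, mul_zero]
  | 1 =>
    rw [hX.numIrr_tower_two, hY.numIrr_tower_two]
    ring
  | n + 2 =>
    zify
    rw [hX.numIrr_tower, hY.numIrr_tower]
    push_cast
    ring

end Numbers

theorem mainTheorem5 (F : Type*) [Field F] [Fintype F] (q : ℕ) (hq : Fintype.card F = q) :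
    (∀ n : ℕ, 6 ≤ n →
      (numIrrCharacters q (pGroup F (n - 1) 2) : ℤ) =
        (q : ℤ) ^ (n - 4) * ((q : ℤ) - 1) * ((q : ℤ) ^ 2 + ((n : ℤ) - 5) * (q : ℤ) + 1)) ∧
    (∀ n : ℕ, 4 ≤ n →
      numIrrCharacters q (qGroup F n 1 3) =
        q ^ 2 * numIrrCharacters q (pGroup F (n - 1) 2)) ∧
    (∀ n : ℕ, 6 ≤ n →
      (numIrrCharacters q (qGroup F n 1 3) : ℤ) =
        (q : ℤ) ^ (n - 2) * ((q : ℤ) - 1) * ((q : ℤ) ^ 2 + ((n : ℤ) - 5) * (q : ℤ) + 1)) ∧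
    numIrrCharacters q (pGroup F 3 2) = 0 ∧
    numIrrCharacters q (qGroup F 4 1 3) = 0 ∧
    (numIrrCharacters q (pGroup F 4 2) : ℤ) = (q : ℤ) * ((q : ℤ) ^ 2 - 1) ∧
    (numIrrCharacters q (qGroup F 5 1 3) : ℤ) =
      (q : ℤ) ^ 3 * ((q : ℤ) ^ 2 - 1) := by
  obtain rfl : Nat.card F = q := Nat.card_eq_fintype_card.trans hq
  have hq2 : 1 ≤ Nat.card F ^ 2 := Nat.one_le_pow _ _ Finite.card_pos
  have hX := isBase_pGroup (F := F)
  have hY := isBase_qGroup (F := F)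
  have hP3 : numIrrCharacters (Nat.card F) (pGroup F 3 2) = 0 :=
    (numIrrCharacters_pGroup F 1).trans hX.numIrr_affine
  have hP4 : (numIrrCharacters (Nat.card F) (pGroup F 4 2) : ℤ) =
      (Nat.card F : ℤ) * ((Nat.card F : ℤ) ^ 2 - 1) := by
    rw [numIrrCharacters_pGroup F 2, hX.numIrr_tower_two]
    push_cast [hq2]
    ring
  have hP : ∀ n : ℕ, 6 ≤ n → (numIrrCharacters (Nat.card F) (pGroup F (n - 1) 2) : ℤ) =
      (Nat.card F : ℤ) ^ (n - 4) * ((Nat.card F : ℤ) - 1) *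
        ((Nat.card F : ℤ) ^ 2 + ((n : ℤ) - 5) * (Nat.card F : ℤ) + 1) := by
    intro n hn
    obtain ⟨m, rfl⟩ := Nat.exists_eq_add_of_le hn
    rw [show 6 + m - 1 = 2 + (m + 3) by omega, show 6 + m - 4 = m + 2 by omega,
      numIrrCharacters_pGroup, hX.numIrr_tower]
    push_cast
    ring
  have hQP : ∀ n : ℕ, 4 ≤ n → numIrrCharacters (Nat.card F) (qGroup F n 1 3) =
      Nat.card F ^ 2 * numIrrCharacters (Nat.card F) (pGroup F (n - 1) 2) := by
    intro n hn
    obtain ⟨m, rfl⟩ := Nat.exists_eq_add_of_le hn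
    rw [show 4 + m - 1 = 2 + (m + 1) by omega, show 4 + m = 3 + (m + 1) by omega,
      numIrrCharacters_pGroup, numIrrCharacters_qGroup]
    exact hX.numIrr_tower_eq_mul F hY m
  refine ⟨hP, hQP, fun n hn => ?_, hP3, ?_, hP4, ?_⟩
  · rw [hQP n (by omega), Nat.cast_mul, hP n hn, show n - 2 = n - 4 + 2 by omega]
    push_cast
    ring
  · rw [hQP 4 le_rfl, hP3, mul_zero]
  · rw [hQP 5 (by omega), Nat.cast_mul, hP4]
    push_cast
    ring
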